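/- \textbf{Theorem (Co-colon capturing).} Let $p$ be a prime number. Conventions: for a commutative ring $R$ of characteristic $p$, $R^\circ$ denotes the set of elements of $R$ that lie in no minimal prime of $R$, and for $e \ge 0$, ${}^eR = \{{}^er : r \in R\}$ denotes the additive group $R$ regarded as an $R$-module via $s\cdot {}^er = {}^e(s^{p^e} r)$. For an $R$-module $N$, $c \in R$ and $e_0 \ge 0$, put \[ N_*[c,p^{e_0}] := \sum_{e \ge e_0} \operatorname{im}\bigl(\operatorname{Hom}_R({}^eR,N) \to N,\ g \mapsto g({}^ec)\bigr), \] and define the \emph{tight interior} of $N$ over $R$ to be \[ N_{*R} := \bigcap_{c \in R^\circ} \bigcap_{e_0 \ge 0} N_*[c,p^{e_0}]. \] A ring of characteristic $p$ is \emph{$F$-finite} if its Frobenius endomorphism is a finite ring map. Let $A$ be a regular (Noetherian) $F$-finite ring of characteristic $p$, and let $A \subseteq R$ be an extension of commutative rings such that $R$ is a finitely generated and torsion-free $A$-module, where torsion-free means that every non-zero-divisor of $A$ acts injectively on $R$. Let $M$ be an arbitrary $A$-module and let $x \in A$. Regard $\operatorname{Hom}_A(R,M)$ and $\operatorname{Hom}_A(R,xM)$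 as $R$-modules via $(r\cdot g)(y) = g(ry)$, and regard $\operatorname{Hom}_A(R,xM)$ as a submodule of $\operatorname{Hom}_A(R,M)$ via the inclusion $xM \subseteq M$. Then \[ \operatorname{Hom}_A(R, xM)_{*R} = x \cdot \operatorname{Hom}_A(R,M)_{*R}. \] -/

import Mathlib

open scoped Pointwise

/-- A commutative ring `A` of prime characteristic `p` is `F`-finite if its Frobenius endomorphism
is a finite ring homomorphism. -/
def IsFFinite (p : ℕ) [Fact p.Prime] (A : Type*) [CommRing A] [CharP A p] : Prop :=
  (frobenius A p).Finite

/-- The module `ᵉM`: the same additive group as `M`, on which `r : R` acts as `r ^ (p ^ e)`. -/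
def FrobeniusTwist (_p _e : ℕ) (M : Type*) : Type _ := M

namespace FrobeniusTwist

instance (p e : ℕ) (M : Type*) [AddCommGroup M] : AddCommGroup (FrobeniusTwist p e M) :=
  inferInstanceAs (AddCommGroup M)

/-- The identity map `M → ᵉM`, `m ↦ ᵉm`. -/
def of (p e : ℕ) (M : Type*) [AddCommGroup M] : M ≃+ FrobeniusTwist p e M :=
  AddEquiv.refl M

noncomputable instance (p e : ℕ) [Fact p.Prime] (R M : Type*) [CommRing R] [CharP R p]
    [AddCommGroup M] [Module R M] : Module R (FrobeniusTwist p e M) :=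
  Module.compHom M (iterateFrobenius R p e)

theorem smul_of (p e : ℕ) [Fact p.Prime] {R M : Type*} [CommRing R] [CharP R p]
    [AddCommGroup M] [Module R M] (r : R) (m : M) :
    r • of p e M m = of p e M (r ^ p ^ e • m) :=
  rfl

end FrobeniusTwist

/-- `R°`: the elements of `R` that lie in no minimal prime of `R`. -/
def offMinimalPrimes (R : Type*) [CommRing R] : Set R :=
  {c | ∀ P ∈ minimalPrimes R, c ∉ P}

/-- `M_*[c, p ^ e₀]`: the sum over all `e ≥ e₀` of the images of the evaluation maps
`Hom_R(ᵉR, M) → M`, `g ↦ g (ᵉc)`. -/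
noncomputable def tightInteriorAt (p : ℕ) [Fact p.Prime] (R M : Type*) [CommRing R] [CharP R p]
    [AddCommGroup M] [Module R M] (c : R) (e₀ : ℕ) : Submodule R M :=
  ⨆ (e : ℕ) (_ : e₀ ≤ e),
    LinearMap.range
      (LinearMap.applyₗ (FrobeniusTwist.of p e R c) : (FrobeniusTwist p e R →ₗ[R] M) →ₗ[R] M)

/-- The tight interior `M_{*R}` of the `R`-module `M`. -/
noncomputable def tightInterior (p : ℕ) [Fact p.Prime] (R M : Type*) [CommRing R] [CharP R p]
    [AddCommGroup M] [Module R M] : Submodule R M :=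
  ⨅ (c : R) (_ : c ∈ offMinimalPrimes R) (e₀ : ℕ), tightInteriorAt p R M c e₀

/-- `Hom_A(R, M)` for an `A`-algebra `R` and an `A`-module `M`, as a type of its own, so that it can
carry the `R`-module structure `(r • g) y = g (y * r)` (next to its usual `A`-module structure). -/
def CoextendedHom (A R M : Type*) [CommRing A] [CommRing R] [Algebra A R]
    [AddCommGroup M] [Module A M] : Type _ :=
  R →ₗ[A] M

namespace CoextendedHom

variable {A R M N : Type*} [CommRing A] [CommRing R] [Algebra A R]
  [AddCommGroup M] [Module A M] [AddCommGroup N] [Module A N]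

instance : AddCommGroup (CoextendedHom A R M) := inferInstanceAs (AddCommGroup (R →ₗ[A] M))

instance : Module A (CoextendedHom A R M) := inferInstanceAs (Module A (R →ₗ[A] M))

instance : FunLike (CoextendedHom A R M) R M := inferInstanceAs (FunLike (R →ₗ[A] M) R M)

@[ext] theorem ext {g h : CoextendedHom A R M} (H : ∀ y, g y = h y) : g = h :=
  DFunLike.ext g h H

instance : SMul R (CoextendedHom A R M) where
  smul r g := LinearMap.comp (show R →ₗ[A] M from g) (LinearMap.mulRight A r)

theorem smul_apply (r : R) (g : CoextendedHom A R M) (y : R) : (r • g) y = g (y * r) := rfl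

theorem smul_apply' (a : A) (g : CoextendedHom A R M) (y : R) : (a • g) y = a • g y := rfl

theorem add_apply (g h : CoextendedHom A R M) (y : R) : (g + h) y = g y + h y := rfl

theorem zero_apply (y : R) : (0 : CoextendedHom A R M) y = 0 := rfl

theorem map_add' (g : CoextendedHom A R M) (y z : R) : g (y + z) = g y + g z :=
  LinearMap.map_add (show R →ₗ[A] M from g) y z

theorem map_zero' (g : CoextendedHom A R M) : g 0 = 0 :=
  LinearMap.map_zero (show R →ₗ[A] M from g)

theorem map_smul' (g : CoextendedHom A R M) (a : A) (y : R) : g (a • y) = a • g y :=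
  LinearMap.map_smul (show R →ₗ[A] M from g) a y

instance : Module R (CoextendedHom A R M) where
  one_smul g := by ext y; simp [smul_apply]
  mul_smul r s g := by ext y; simp only [smul_apply]; congr 1; ring
  smul_zero r := by ext y; simp [smul_apply, zero_apply]
  smul_add r g h := by ext y; simp [smul_apply, add_apply]
  add_smul r s g := by ext y; simp [smul_apply, add_apply, mul_add, map_add']
  zero_smul g := by ext y; simp [smul_apply, zero_apply, map_zero']

instance : IsScalarTower A R (CoextendedHom A R M) where
  smul_assoc a r g := by ext y; simp [smul_apply, smul_apply', map_smul']

instance : SMulCommClass A R (CoextendedHom A R M) where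
  smul_comm a r g := by ext y; simp [smul_apply, smul_apply']

/-- The `R`-linear map `Hom_A(R, M) → Hom_A(R, N)`, `g ↦ f ∘ g`, induced by an `A`-linear map
`f : M → N`. -/
def map (R : Type*) [CommRing R] [Algebra A R] (f : M →ₗ[A] N) :
    CoextendedHom A R M →ₗ[R] CoextendedHom A R N where
  toFun g := LinearMap.comp f (show R →ₗ[A] M from g)
  map_add' g h := LinearMap.comp_add g h f
  map_smul' _ _ := rfl

theorem map_apply (f : M →ₗ[A] N) (g : CoextendedHom A R M) (y : R) : map R f g y = f (g y) := rfl

end CoextendedHom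

/-!
Write `q = p ^ e`. Under the adjunction `Hom_R(ᵉR, Hom_A(R, N)) ≃ Hom_A(ᵉR, N)`, a value `G (ᵉc)`
of a map into `Hom_A(R, N)` is the map `y ↦ h (ᵉ(y ^ q * c))` for an `A`-linear `h : ᵉR → N`.
Suppose `N = xM`. If `ᵉR` were a projective `A`-module, `h` would lift along `x : M → xM`, and
`G (ᵉc)` would be `x` times a value at `ᵉc` of a map into `Hom_A(R, M)`. Two facts make up for the
failure of projectivity.

*Capturing.* By Kunz's theorem, `ᵉA` is projective over the regular ring `A`
(`IsRegularRing.projective_frobeniusTwist`), and multiplication by some non-zero-divisor `c` of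
`A` on `R` factors through a finite free `A`-module
(`exists_mem_nonZeroDivisors_algebraMap_mem_rankOneSpan`). Hence `h ∘ ᵉc` lifts, for every `e`
(`exists_lift_of_mem_rankOneSpan`), and `Hom_A(R, xM)_*[cd, p ^ m]` lies in
`x • Hom_A(R, M)_*[d, p ^ m]` for every `d` and `m` (`map_subtype_tightInteriorAt_mul_le`).

*Test elements.* The lift depends on `d`, so a single pair `(d, m)` is needed for which
`N_*[d, p ^ m]` is the whole tight interior (`exists_tightInterior_eq_tightInteriorAt`).
Projectivity of `ᵉA` and Krull's intersection theorem show that for each non-zero-divisor `a` of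
`A` there are arbitrarily large `e` and `A`-linear `f : ᵉA → A` with `f (ᵉa) = 1`
(`exists_frobeniusTwist_linearMap_apply_eq_one`). Such an `f` is transferred to an `R`-linear map
`ᵉR → ᵐR` whose value at `ᵉa` is `ᵐ(d * f (ᵉ(a ^ p ^ m)))`, with `d` and `m` independent of `e`
and `f` (`mul_pow_mem_frobeniusTransferIdeal`). Over the residue field `K` at a minimal prime of
`A`, the spans of `p ^ m`-th powers of elements of `R` form a decreasing chain. Once it is
stationary, a basis `bᵢ` consisting of `p ^ m`-th powers has the property that the `bᵢ ^ q` are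
again a basis for every `e`, and the transferred map is `∑ αᵢ bᵢ ^ q ↦ ∑ f (ᵉαᵢ) bᵢ` up to
denominators. These stay bounded because `1 + 1 / p + 1 / p ^ 2 + ⋯ ≤ 2`. The elements `d` that
work form an ideal, so the contributions of the minimal primes combine by prime avoidance.

The reverse inclusion is functoriality of the tight interior along `x : M → xM`
(`map_tightInterior_le`).
-/

/-! ### Regular sequences and freeness over local rings -/

section

open RingTheory.Sequence

/-- In a short exact sequence `0 → M₁ → M₂ → M₃ → 0`, a sequence that is weakly regular on the
outer terms is weakly regular on the middle one: regularity of the first element on `M₃` keeps the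
sequence exact modulo that element. -/
theorem RingTheory.Sequence.IsWeaklyRegular.of_exact {A : Type*} [CommRing A] (rs : List A) :
    ∀ {M₁ M₂ M₃ : Type _} [AddCommGroup M₁] [AddCommGroup M₂] [AddCommGroup M₃]
      [Module A M₁] [Module A M₂] [Module A M₃] (f : M₁ →ₗ[A] M₂) (g : M₂ →ₗ[A] M₃),
      Function.Injective f → Function.Exact f g → Function.Surjective g →
      IsWeaklyRegular M₁ rs → IsWeaklyRegular M₃ rs → IsWeaklyRegular M₂ rs := by
  induction rs with
  | nil => intros; exact .nil A _
  | cons r rs ih =>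
    intro M₁ M₂ M₃ _ _ _ _ _ _ f g hf hfg hg h₁ h₃
    rw [isWeaklyRegular_cons_iff] at h₁ h₃ ⊢
    refine ⟨isSMulRegular_of_range_eq_ker hf (LinearMap.exact_iff.mp hfg).symm h₁.1 h₃.1,
      ih (QuotSMulTop.map r f) (QuotSMulTop.map r g) ?_ (QuotSMulTop.map_exact r hfg hg)
        (QuotSMulTop.map_surjective r hg) h₁.2 h₃.2⟩
    rw [injective_iff_map_eq_zero]
    intro y hy
    obtain ⟨y, rfl⟩ := Submodule.mkQ_surjective _ y
    have hy' : f y ∈ r • (⊤ : Submodule A M₂) := (Submodule.Quotient.mk_eq_zero _).mp hy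
    obtain ⟨z, -, hz⟩ := (Submodule.mem_smul_pointwise_iff_exists _ _ _).mp hy'
    have hgz : g z = 0 := h₃.1 <| by
      change r • g z = r • 0
      rw [← map_smul, hz, smul_zero, hfg.apply_apply_eq_zero]
    obtain ⟨w, rfl⟩ := (hfg z).mp hgz
    rw [← map_smul] at hz
    refine (Submodule.Quotient.mk_eq_zero _).mpr ?_
    exact (Submodule.mem_smul_pointwise_iff_exists _ _ _).mpr ⟨w, trivial, hf hz⟩

/-- Induction on `n` along `0 → M / xⁿM → M / xⁿ⁺¹M → M / xM → 0`, whose first map is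
multiplication by `x`. -/
theorem RingTheory.Sequence.IsWeaklyRegular.quotSMulTop_pow {A M : Type*} [CommRing A]
    [AddCommGroup M] [Module A M] {x : A} {rs : List A} (hx : IsSMulRegular M x)
    (h : IsWeaklyRegular (QuotSMulTop x M) rs) (n : ℕ) :
    IsWeaklyRegular (QuotSMulTop (x ^ n) M) rs := by
  have key (n : ℕ) (y : M) : y ∈ x ^ n • (⊤ : Submodule A M) ↔ ∃ z, x ^ n • z = y := by
    simp [Submodule.mem_smul_pointwise_iff_exists]
  have key₁ (y : M) : y ∈ x • (⊤ : Submodule A M) ↔ ∃ z, x • z = y := by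
    simp [Submodule.mem_smul_pointwise_iff_exists]
  induction n with
  | zero =>
    have : Subsingleton (QuotSMulTop (x ^ 0) M) := by
      rw [pow_zero, QuotSMulTop, one_smul]; infer_instance
    exact (isWeaklyRegular_iff_Fin _ _).mpr fun i => Function.injective_of_subsingleton _
  | succ n ih =>
    let f : QuotSMulTop (x ^ n) M →ₗ[A] QuotSMulTop (x ^ (n + 1)) M :=
      Submodule.mapQ _ _ (LinearMap.lsmul A M x) <| fun y hy => by
        obtain ⟨z, rfl⟩ := (key n y).mp hy
        exact (key (n + 1) _).mpr ⟨z, by rw [pow_succ', mul_smul, LinearMap.lsmul_apply]⟩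
    let g : QuotSMulTop (x ^ (n + 1)) M →ₗ[A] QuotSMulTop x M :=
      Submodule.mapQ _ _ LinearMap.id <| fun y hy => by
        obtain ⟨z, rfl⟩ := (key (n + 1) y).mp hy
        exact (key₁ _).mpr ⟨x ^ n • z, by simp [smul_smul, pow_succ']⟩
    refine .of_exact rs f g ?_ ?_ ?_ ih h
    · rw [injective_iff_map_eq_zero]
      intro y hy
      obtain ⟨y, rfl⟩ := Submodule.mkQ_surjective _ y
      obtain ⟨z, hz⟩ := (key (n + 1) _).mp ((Submodule.Quotient.mk_eq_zero _).mp hy)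
      refine (Submodule.Quotient.mk_eq_zero _).mpr ((key n _).mpr ⟨z, hx ?_⟩)
      simpa [smul_smul, pow_succ'] using hz
    · intro y
      obtain ⟨y, rfl⟩ := Submodule.mkQ_surjective _ y
      constructor
      · intro hy
        obtain ⟨z, rfl⟩ := (key₁ _).mp ((Submodule.Quotient.mk_eq_zero _).mp hy)
        exact ⟨Submodule.Quotient.mk z, rfl⟩
      · rintro ⟨z, hz⟩
        obtain ⟨z, rfl⟩ := Submodule.mkQ_surjective _ z
        rw [← hz]
        exact (Submodule.Quotient.mk_eq_zero _).mpr ((key₁ _).mpr ⟨z, rfl⟩)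
    · intro y
      obtain ⟨y, rfl⟩ := Submodule.mkQ_surjective _ y
      exact ⟨Submodule.Quotient.mk y, rfl⟩

/-- Powers of the members of a weakly regular sequence form a weakly regular sequence. -/
theorem RingTheory.Sequence.IsWeaklyRegular.map_pow {A : Type*} [CommRing A] {rs : List A} (n : ℕ) :
    ∀ {M : Type _} [AddCommGroup M] [Module A M], IsWeaklyRegular M rs →
      IsWeaklyRegular M (rs.map (· ^ n)) := by
  induction rs with
  | nil => intros; exact .nil A _
  | cons r rs ih =>
    intro M _ _ h
    rw [isWeaklyRegular_cons_iff] at h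
    rw [List.map_cons, isWeaklyRegular_cons_iff]
    exact ⟨h.1.pow n, (ih h.2).quotSMulTop_pow h.1 n⟩

/-- A finite module over a Noetherian local ring is free as soon as generators of the maximal
ideal form a weakly regular sequence on it. This is the only case of the Auslander–Buchsbaum
formula that is needed; freeness is lifted along one member of the sequence at a time. -/
theorem Module.free_of_isWeaklyRegular_of_ofList_eq_maximalIdeal (d : ℕ) :
    ∀ {A : Type _} [CommRing A] [IsLocalRing A] [IsNoetherianRing A]
      {M : Type _} [AddCommGroup M] [Module A M] [Module.Finite A M] (rs : List A), rs.length = d →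
      Ideal.ofList rs = IsLocalRing.maximalIdeal A → IsWeaklyRegular M rs → Module.Free A M := by
  induction d with
  | zero =>
    intro A _ _ _ M _ _ _ rs hd hrs _
    obtain rfl := List.eq_nil_of_length_eq_zero hd
    rw [Ideal.ofList_nil] at hrs
    let := (IsLocalRing.isField_iff_maximalIdeal_eq.mpr hrs.symm).toField
    infer_instance
  | succ d ih =>
    intro A _ _ _ M _ _ _ rs hd hrs h
    obtain ⟨r, rs, rfl⟩ := List.exists_cons_of_length_eq_add_one hd
    have hr : r ∈ IsLocalRing.maximalIdeal A := by
      rw [← hrs]; exact Ideal.subset_span List.mem_cons_self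
    rw [isWeaklyRegular_cons_iff'] at h
    have := Module.finitePresentation_of_finite A M
    rw [← Module.free_quotSMulTop_iff_free A M
      (by rwa [IsLocalRing.jacobson_eq_maximalIdeal _ bot_ne_top]) h.1]
    have : Nontrivial (A ⧸ Ideal.span {r}) := Ideal.Quotient.nontrivial_iff.mpr <| by
      rwa [ne_eq, Ideal.span_singleton_eq_top, ← mem_nonunits_iff]
    have : IsLocalRing (A ⧸ Ideal.span {r}) := .of_surjective' _ Ideal.Quotient.mk_surjective
    have : Module.Finite (A ⧸ Ideal.span {r}) (QuotSMulTop r M) :=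
      Module.Finite.of_restrictScalars_finite A _ _
    refine ih _ (by simpa using hd) ?_ h.2
    rw [← Ideal.map_ofList,
      ← IsLocalRing.map_maximalIdeal_of_surjective _ Ideal.Quotient.mk_surjective, ← hrs,
      Ideal.ofList_cons, Ideal.map_sup, Ideal.map_span]
    simp

/-- By prime avoidance, in which one of the ideals avoided need not be prime. -/
theorem IsLocalRing.exists_mem_maximalIdeal_notMem_sq {A : Type*} [CommRing A] [IsLocalRing A]
    [IsNoetherianRing A] (h : 0 < ringKrullDim A) :
    ∃ x ∈ maximalIdeal A, x ∉ maximalIdeal A ^ 2 ∧ ∀ P ∈ minimalPrimes A, x ∉ P := by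
  classical
  by_contra! H
  have hfin := minimalPrimes.finite_of_isNoetherianRing A
  have hcov : (maximalIdeal A : Set A) ⊆
      ⋃ I ∈ ((insert (maximalIdeal A ^ 2) hfin.toFinset : Finset (Ideal A)) : Set (Ideal A)),
        (id I : Ideal A) := by
    intro x hx
    by_cases hx2 : x ∈ maximalIdeal A ^ 2
    · exact Set.mem_biUnion (by simp) hx2
    · obtain ⟨P, hP, hxP⟩ := H x hx hx2
      exact Set.mem_biUnion (by simp [hP]) hxP
  rw [Ideal.subset_union_prime (maximalIdeal A ^ 2) (maximalIdeal A ^ 2)] at hcov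
  · obtain ⟨I, hI, hle⟩ := hcov
    rw [Finset.mem_insert, Set.Finite.mem_toFinset] at hI
    have hm : maximalIdeal A ∈ minimalPrimes A := by
      rcases hI with rfl | hI
      · have hbot : maximalIdeal A = ⊥ := by
          refine Submodule.eq_bot_of_le_smul_of_le_jacobson_bot (maximalIdeal A) _
            (IsNoetherian.noetherian _) ?_ (maximalIdeal_le_jacobson _)
          simpa [pow_two] using hle
        exact ⟨⟨inferInstance, bot_le⟩, fun _ _ _ => hbot.trans_le bot_le⟩
      · rwa [show maximalIdeal A = I from le_antisymm hle (le_maximalIdeal hI.1.1.ne_top)]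
    rw [← maximalIdeal_height_eq_ringKrullDim, Ideal.height_eq_zero_iff.mpr hm] at h
    exact lt_irrefl _ h
  · intro I hI hI1 _
    rw [Finset.mem_insert, Set.Finite.mem_toFinset] at hI
    exact (hI.resolve_left hI1).1.1

/-- An element of `𝔪` outside `𝔪²` can replace one of any given family of generators of `𝔪`. -/
theorem IsLocalRing.exists_span_singleton_sup_eq {A : Type*} [CommRing A] [IsLocalRing A] {n : ℕ}
    (s : Fin (n + 1) → A) (hs : Ideal.span (Set.range s) = maximalIdeal A) {x : A}
    (hx : x ∈ maximalIdeal A) (hx2 : x ∉ maximalIdeal A ^ 2) :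
    ∃ t : Fin n → A, Ideal.span {x} ⊔ Ideal.span (Set.range t) = maximalIdeal A := by
  have hsm (i) : s i ∈ maximalIdeal A := hs ▸ Ideal.subset_span ⟨i, rfl⟩
  rw [← hs, Ideal.mem_span_range_iff_exists_fun] at hx
  obtain ⟨c, hc⟩ := hx
  obtain ⟨i, hi⟩ : ∃ i, IsUnit (c i) := by
    by_contra! H
    exact hx2 <| hc ▸ sum_mem fun i _ => pow_two (maximalIdeal A) ▸
      Ideal.mul_mem_mul ((mem_maximalIdeal _).mpr (H i)) (hsm i)
  refine ⟨fun j => s (i.succAbove j), le_antisymm ?_ ?_⟩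
  · refine sup_le ?_ (Ideal.span_le.mpr ?_)
    · rw [Ideal.span_singleton_le_iff_mem, ← hc]
      exact sum_mem fun i _ => Ideal.mul_mem_left _ _ (hsm i)
    · rintro _ ⟨j, rfl⟩
      exact hsm _
  · rw [← hs, Ideal.span_le]
    have ht (j : Fin n) : s (i.succAbove j) ∈
        Ideal.span {x} ⊔ Ideal.span (Set.range fun j => s (i.succAbove j)) :=
      Ideal.mem_sup_right (Ideal.subset_span ⟨j, rfl⟩)
    rintro _ ⟨k, rfl⟩
    obtain rfl | ⟨j, rfl⟩ := Fin.eq_self_or_eq_succAbove i k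
    · rw [Fin.sum_univ_succAbove _ k] at hc
      refine (Ideal.unit_mul_mem_iff_mem _ hi).mp ?_
      rw [← eq_sub_iff_add_eq] at hc
      rw [hc]
      exact sub_mem (Ideal.mem_sup_left (Ideal.mem_span_singleton_self x))
        (sum_mem fun j _ => Ideal.mul_mem_left _ _ (ht j))
    · exact ht j

/-- If `(x)` is prime and `P ≤ (x)` is a minimal prime, then `x ∉ P` forces `P = xP`, so that
`P = 0` by Nakayama. -/
theorem IsLocalRing.isDomain_of_isDomain_quotient {A : Type*} [CommRing A] [IsLocalRing A]
    [IsNoetherianRing A] {x : A} (hx : x ∈ maximalIdeal A) (hxP : ∀ P ∈ minimalPrimes A, x ∉ P)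
    [IsDomain (A ⧸ Ideal.span {x})] : IsDomain A := by
  have hprime : (Ideal.span {x}).IsPrime := (Ideal.Quotient.isDomain_iff_prime _).mp ‹_›
  obtain ⟨P, hP, hPx⟩ := Ideal.exists_minimalPrimes_le (bot_le (a := Ideal.span {x}))
  have hPp : P.IsPrime := hP.1.1
  have hbot : P = ⊥ := by
    refine Submodule.eq_bot_of_le_smul_of_le_jacobson_bot (Ideal.span {x}) _
      (IsNoetherian.noetherian _) ?_ ?_
    · intro y hy
      obtain ⟨z, rfl⟩ := Ideal.mem_span_singleton'.mp (hPx hy)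
      rw [smul_eq_mul, mul_comm z x]
      exact Ideal.mul_mem_mul (Ideal.mem_span_singleton_self x)
        ((hPp.mem_or_mem hy).resolve_right (hxP P hP))
    · rw [Ideal.span_singleton_le_iff_mem, jacobson_eq_maximalIdeal _ bot_ne_top]
      exact hx
  rw [hbot] at hPp
  exact IsDomain.of_bot_isPrime A

/-- If the maximal ideal of a Noetherian local ring `A` is generated by at most `dim A` elements,
then `A` is a domain and some generators of the maximal ideal form a regular sequence. Both are
proved in one induction, since the domain property of `A / x` gives that of `A`, hence the
regularity of `x`. -/
theorem IsLocalRing.exists_isWeaklyRegular_of_le_ringKrullDim (n : ℕ) :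
    ∀ {A : Type _} [CommRing A] [IsLocalRing A] [IsNoetherianRing A] (s : Fin n → A),
      Ideal.span (Set.range s) = maximalIdeal A → n ≤ ringKrullDim A →
      IsDomain A ∧ ∃ rs : List A, Ideal.ofList rs = maximalIdeal A ∧ IsWeaklyRegular A rs := by
  induction n with
  | zero =>
    intro A _ _ _ s hs _
    have hbot : maximalIdeal A = ⊥ := by rw [← hs]; simp
    let := (isField_iff_maximalIdeal_eq.mpr hbot).toField
    exact ⟨inferInstance, [], by rw [hbot, Ideal.ofList_nil], .nil A A⟩
  | succ n ih =>
    intro A _ _ _ s hs hn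
    obtain ⟨x, hx, hx2, hxP⟩ := exists_mem_maximalIdeal_notMem_sq (A := A)
      (lt_of_lt_of_le (by exact_mod_cast n.succ_pos) hn)
    obtain ⟨t, ht⟩ := exists_span_singleton_sup_eq s hs hx hx2
    have : Nontrivial (A ⧸ Ideal.span {x}) := Ideal.Quotient.nontrivial_iff.mpr <| by
      rwa [ne_eq, Ideal.span_singleton_eq_top, ← mem_nonunits_iff]
    have : IsLocalRing (A ⧸ Ideal.span {x}) := .of_surjective' _ Ideal.Quotient.mk_surjective
    have hmap : (maximalIdeal A).map (Ideal.Quotient.mk (Ideal.span {x})) =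
        maximalIdeal (A ⧸ Ideal.span {x}) :=
      map_maximalIdeal_of_surjective _ Ideal.Quotient.mk_surjective
    have hdim : (n : WithBot ℕ∞) ≤ ringKrullDim (A ⧸ Ideal.span {x}) := by
      have := hn.trans (ringKrullDim_le_ringKrullDim_quotient_add_card {x}
        (by simpa [ringJacobson_eq_maximalIdeal] using hx))
      rw [Finset.card_singleton, Finset.coe_singleton, Nat.cast_succ, Nat.cast_one] at this
      exact ENat.WithBot.add_le_add_one_right_iff.mp this
    obtain ⟨hdom, rs, hrs, hreg⟩ := ih (Ideal.Quotient.mk (Ideal.span {x}) ∘ t) (by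
      rw [← hmap, ← ht, Ideal.map_sup, Set.range_comp, Ideal.map_span, Ideal.map_span]
      simp) hdim
    have hA : IsDomain A := isDomain_of_isDomain_quotient hx hxP
    obtain ⟨rs, rfl⟩ :=
      List.map_surjective_iff.mpr (Ideal.Quotient.mk_surjective (I := Ideal.span {x})) rs
    refine ⟨hA, x :: rs, ?_, ?_⟩
    · rw [← Ideal.map_ofList, ← hmap] at hrs
      have := congrArg (Ideal.comap (Ideal.Quotient.mk (Ideal.span {x}))) hrs
      rwa [Ideal.comap_map_of_surjective' _ Ideal.Quotient.mk_surjective,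
        Ideal.comap_map_of_surjective' _ Ideal.Quotient.mk_surjective, Ideal.mk_ker,
        sup_comm, ← Ideal.ofList_cons, sup_eq_left.mpr
          ((Ideal.span_singleton_le_iff_mem _).mpr hx)] at this
    · rw [isWeaklyRegular_cons_iff]
      refine ⟨?_, ?_⟩
      · have : x ≠ 0 := by
          rintro rfl
          exact hx2 (zero_mem _)
        exact fun a b hab => mul_left_cancel₀ this hab
      · have e : (A ⧸ Ideal.span {x}) ≃ₗ[A] QuotSMulTop x A :=
          Submodule.quotEquivOfEq _ _ <| by
            rw [← Submodule.ideal_span_singleton_smul, smul_eq_mul, Ideal.mul_top]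
        rw [← e.isWeaklyRegular_congr, ← isWeaklyRegular_map_algebraMap_iff (A ⧸ Ideal.span {x})]
        exact hreg

theorem IsRegularLocalRing.exists_isWeaklyRegular (A : Type*) [CommRing A] [IsRegularLocalRing A] :
    ∃ rs : List A, Ideal.ofList rs = IsLocalRing.maximalIdeal A ∧ IsWeaklyRegular A rs := by
  obtain ⟨s, hs, hspan⟩ := Submodule.FG.exists_span_finset_card_eq_spanFinrank
    (IsNoetherian.noetherian (IsLocalRing.maximalIdeal A))
  refine (IsLocalRing.exists_isWeaklyRegular_of_le_ringKrullDim s.card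
    (fun i => (s.equivFin.symm i : A)) ?_ ?_).2
  · rw [← hspan, Ideal.span]
    congr 1
    ext y
    exact ⟨fun ⟨i, hi⟩ => hi ▸ (s.equivFin.symm i).2, fun hy => ⟨s.equivFin ⟨y, hy⟩, by simp⟩⟩
  · rw [hs, IsRegularLocalRing.spanFinrank_maximalIdeal]

/-! ### Kunz's theorem for `F`-finite regular rings -/

theorem IsFFinite.finite_frobeniusTwist {p : ℕ} [Fact p.Prime] {A : Type*} [CommRing A] [CharP A p]
    (hA : IsFFinite p A) (e : ℕ) : Module.Finite A (FrobeniusTwist p e A) := by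
  have : (iterateFrobenius A p e).Finite := by
    induction e with
    | zero =>
      rw [iterateFrobenius_zero]
      exact RingHom.Finite.id A
    | succ e ih =>
      have : iterateFrobenius A p (e + 1) = (frobenius A p).comp (iterateFrobenius A p e) := by
        ext x
        simp [iterateFrobenius_def, frobenius_def, pow_succ, pow_mul]
      rw [this]
      exact RingHom.Finite.comp hA ih
  exact this

/-- Local form of Kunz's theorem: generators `xᵢ` of the maximal ideal that form a regular
sequence act on `ᵉA` as the `xᵢ ^ p ^ e` act on `A`, that is, again as a weakly regular sequence.
-/
theorem IsRegularLocalRing.free_frobeniusTwist {p : ℕ} [Fact p.Prime] (e : ℕ) (A : Type*)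
    [CommRing A] [CharP A p] [IsRegularLocalRing A] [Module.Finite A (FrobeniusTwist p e A)] :
    Module.Free A (FrobeniusTwist p e A) := by
  obtain ⟨rs, hrs, hreg⟩ := IsRegularLocalRing.exists_isWeaklyRegular A
  refine Module.free_of_isWeaklyRegular_of_ofList_eq_maximalIdeal rs.length rs rfl hrs ?_
  refine (AddEquiv.isWeaklyRegular_congr (e := FrobeniusTwist.of p e A) ?_).mp
    (hreg.map_pow (p ^ e))
  rw [List.forall₂_map_left_iff, List.forall₂_same]
  exact fun r _ x => rfl

theorem Localization.charP_of_nontrivial (p : ℕ) [Fact p.Prime] (A : Type*) [CommRing A] [CharP A p]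
    (S : Submonoid A) [Nontrivial (Localization S)] : CharP (Localization S) p := by
  refine (CharP.charP_iff_prime_eq_zero (Fact.out : p.Prime)).mpr ?_
  rw [← map_natCast (algebraMap A (Localization S)), CharP.cast_eq_zero, map_zero]

section

variable (p e : ℕ) [Fact p.Prime] (A : Type*) [CommRing A] [CharP A p] (S : Submonoid A)
  [CharP (Localization S) p]

instance FrobeniusTwist.isScalarTower_localization :
    IsScalarTower A (Localization S) (FrobeniusTwist p e (Localization S)) where
  smul_assoc a l m := by
    change (a • l) ^ p ^ e * (of p e _).symm m = a ^ p ^ e • (l ^ p ^ e * (of p e _).symm m)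
    rw [smul_pow, smul_mul_assoc]

/-- The map `ᵉA → ᵉ(S⁻¹A)`. It is a localization of the `A`-module `ᵉA`, since inverting `s` and
inverting `s ^ p ^ e` amount to the same. -/
noncomputable def FrobeniusTwist.localizationMap :
    FrobeniusTwist p e A →ₗ[A] FrobeniusTwist p e (Localization S) where
  toFun a := of p e _ (algebraMap A (Localization S) ((of p e A).symm a))
  map_add' a b := by simp
  map_smul' r a := by
    change algebraMap A (Localization S) (r ^ p ^ e * (of p e A).symm a) =
      r ^ p ^ e • algebraMap A (Localization S) ((of p e A).symm a)
    rw [map_mul, Algebra.smul_def]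

instance FrobeniusTwist.isLocalizedModule_localizationMap :
    IsLocalizedModule S (localizationMap p e A S) where
  map_units s := by
    have hs : IsUnit (algebraMap A (Localization S) (s ^ p ^ e)) :=
      IsLocalization.map_units _ (s ^ p ^ e)
    rw [Module.End.isUnit_iff]
    have : (algebraMap A (Module.End A (FrobeniusTwist p e (Localization S))) s :
        FrobeniusTwist p e (Localization S) → FrobeniusTwist p e (Localization S)) =
        fun m : Localization S => algebraMap A (Localization S) (s ^ p ^ e) * m := by
      funext m
      exact Algebra.smul_def (A := Localization S) ((s : A) ^ p ^ e) m
    rw [this]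
    exact IsUnit.isUnit_iff_mulLeft_bijective.mp hs
  surj m := by
    obtain ⟨⟨a, s⟩, h⟩ := IsLocalization.surj S (show Localization S from m)
    -- `a / s = s ^ (q - 1) * a / s ^ q` with `q = p ^ e`, and `s` acts on the twist as `s ^ q`.
    refine ⟨⟨of p e A (s ^ (p ^ e - 1) * a), s⟩, ?_⟩
    change (s : A) ^ p ^ e • (show Localization S from m) =
      algebraMap A (Localization S) (s ^ (p ^ e - 1) * a)
    have hq : p ^ e = p ^ e - 1 + 1 :=
      (Nat.sub_add_cancel (Nat.one_le_pow _ _ (Fact.out : p.Prime).pos)).symm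
    rw [map_mul, ← h, Algebra.smul_def]
    nth_rw 1 [hq]
    rw [pow_succ, map_mul]
    ring
  exists_of_eq {a b} h := by
    obtain ⟨s, hs⟩ := (IsLocalization.eq_iff_exists S (Localization S)).mp h
    refine ⟨s, ?_⟩
    change (s : A) ^ p ^ e * (of p e A).symm a = (s : A) ^ p ^ e * (of p e A).symm b
    have hq : p ^ e = p ^ e - 1 + 1 :=
      (Nat.sub_add_cancel (Nat.one_le_pow _ _ (Fact.out : p.Prime).pos)).symm
    rw [hq, pow_succ, mul_assoc, mul_assoc]
    exact congrArg _ hs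

end

/-- Kunz's theorem, in the direction from regularity to flatness of Frobenius, for `F`-finite
rings. -/
theorem IsRegularRing.projective_frobeniusTwist {p : ℕ} [Fact p.Prime] {A : Type*} [CommRing A]
    [CharP A p] [IsRegularRing A] (hA : IsFFinite p A) (e : ℕ) :
    Module.Projective A (FrobeniusTwist p e A) := by
  have := hA.finite_frobeniusTwist e
  have := Module.finitePresentation_of_finite A (FrobeniusTwist p e A)
  have (P : Ideal A) [P.IsMaximal] : CharP (Localization.AtPrime P) p :=
    Localization.charP_of_nontrivial p A _
  have hflat : Module.Flat A (FrobeniusTwist p e A) := by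
    refine Module.flat_of_isLocalized_maximal A (FrobeniusTwist p e A)
      (fun P _ => FrobeniusTwist p e (Localization.AtPrime P))
      (fun P _ => FrobeniusTwist.localizationMap p e A P.primeCompl) fun P _ => ?_
    have : Module.Finite (Localization.AtPrime P) (FrobeniusTwist p e (Localization.AtPrime P)) :=
      Module.Finite.of_isLocalizedModule P.primeCompl
        (FrobeniusTwist.localizationMap p e A P.primeCompl)
    have := IsRegularLocalRing.free_frobeniusTwist (p := p) e (Localization.AtPrime P)
    exact .trans A (Localization.AtPrime P) _
  exact Module.Flat.projective_of_finitePresentation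

end

/-! ### Linear forms on Frobenius twists -/

/-- An element `v` of a projective module is the combination of the members of a dual basis with
coefficients the values of linear forms at `v`. -/
theorem Module.Projective.mem_smul_top_of_forall_dual_mem {A P : Type*} [CommRing A]
    [AddCommGroup P] [Module A P] [Module.Projective A P] {I : Ideal A} {v : P}
    (h : ∀ f : P →ₗ[A] A, f v ∈ I) : v ∈ I • (⊤ : Submodule A P) := by
  obtain ⟨s, hs⟩ := Module.projective_def'.mp ‹Module.Projective A P›
  rw [← LinearMap.id_apply (R := A) v, ← hs, LinearMap.comp_apply, Finsupp.linearCombination_apply]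
  exact sum_mem fun i _ =>
    Submodule.smul_mem_smul (h (Finsupp.lapply i ∘ₗ s)) trivial

section

variable {p : ℕ} [Fact p.Prime] {A : Type*} [CommRing A] [CharP A p]

theorem FrobeniusTwist.mem_pow_of_mem_smul_top {e : ℕ} {I : Ideal A} {a : A}
    (h : of p e A a ∈ I • (⊤ : Submodule A (FrobeniusTwist p e A))) : a ∈ I ^ p ^ e := by
  suffices ∀ m ∈ I • (⊤ : Submodule A (FrobeniusTwist p e A)), (of p e A).symm m ∈ I ^ p ^ e from
    this _ h
  intro m hm
  induction hm using Submodule.smul_induction_on' with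
  | smul r hr n _ => exact Ideal.mul_mem_right _ _ (Ideal.pow_mem_pow hr _)
  | add m _ n _ hm hn => exact add_mem hm hn

variable (p) in
/-- The ideal of all values at `ᵉa` of `A`-linear maps `ᵉA → A`. -/
noncomputable def frobeniusTraceIdeal (e : ℕ) (a : A) : Ideal A :=
  LinearMap.range (LinearMap.applyₗ (FrobeniusTwist.of p e A a) :
    (FrobeniusTwist p e A →ₗ[A] A) →ₗ[A] A)

theorem mem_frobeniusTraceIdeal {e : ℕ} {a b : A} :
    b ∈ frobeniusTraceIdeal p e a ↔
      ∃ f : FrobeniusTwist p e A →ₗ[A] A, f (FrobeniusTwist.of p e A a) = b := Iff.rfl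

theorem mem_pow_of_frobeniusTraceIdeal_le {e : ℕ} [Module.Projective A (FrobeniusTwist p e A)]
    {I : Ideal A} {a : A} (h : frobeniusTraceIdeal p e a ≤ I) : a ∈ I ^ p ^ e :=
  FrobeniusTwist.mem_pow_of_mem_smul_top <|
    Module.Projective.mem_smul_top_of_forall_dual_mem fun f => h ⟨f, rfl⟩

/-- Frobenius splits: the unit is not in any `𝔪 ^ p ^ e`, so no maximal ideal contains all values.
-/
theorem frobeniusTraceIdeal_one_eq_top (e : ℕ) [Module.Projective A (FrobeniusTwist p e A)] :
    frobeniusTraceIdeal p e (1 : A) = ⊤ := by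
  by_contra h
  obtain ⟨m, hm, hle⟩ := Ideal.exists_le_maximal _ h
  exact (Ideal.ne_top_iff_one m).mp hm.ne_top
    (Ideal.pow_le_self (pow_ne_zero _ (Fact.out : p.Prime).ne_zero)
      (mem_pow_of_frobeniusTraceIdeal_le hle))

/-- A splitting of Frobenius makes Frobenius injective. -/
theorem isReduced_of_projective_frobeniusTwist [Module.Projective A (FrobeniusTwist p 1 A)] :
    IsReduced A := by
  obtain ⟨f, hf⟩ := mem_frobeniusTraceIdeal.mp
    ((Ideal.eq_top_iff_one _).mp (frobeniusTraceIdeal_one_eq_top (p := p) (A := A) 1))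
  have key (a : A) (h : a ^ p = 0) : a = 0 := by
    have := map_smul f a (FrobeniusTwist.of p 1 A 1)
    rw [hf, FrobeniusTwist.smul_of, pow_one, h, zero_smul, map_zero, map_zero] at this
    simpa using this.symm
  refine isReduced_iff_pow_one_lt p (Fact.out : p.Prime).one_lt |>.mpr key

/-- A splitting of Frobenius sends `ᵉ⁺¹(aᵖ)` to `ᵉa`, and multiplication by `a ^ (p - 1)` sends
`ᵉ⁺¹a` to `ᵉ⁺¹(aᵖ)`. -/
theorem frobeniusTraceIdeal_mono [Module.Projective A (FrobeniusTwist p 1 A)] (a : A) :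
    Monotone fun e => frobeniusTraceIdeal p e a := by
  refine monotone_nat_of_le_succ fun e => ?_
  rintro _ ⟨f, rfl⟩
  obtain ⟨s, hs⟩ := mem_frobeniusTraceIdeal.mp
    ((Ideal.eq_top_iff_one _).mp (frobeniusTraceIdeal_one_eq_top (p := p) (A := A) 1))
  refine ⟨{ toFun := fun m => f (FrobeniusTwist.of p e A
              (s (FrobeniusTwist.of p 1 A (a ^ (p - 1) * (FrobeniusTwist.of p (e + 1) A).symm m))))
            map_add' := fun m n => by simp only [map_add, mul_add]
            map_smul' := fun r m => ?_ }, ?_⟩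
  · have : a ^ (p - 1) * (FrobeniusTwist.of p (e + 1) A).symm (r • m) =
        (r ^ p ^ e) ^ p ^ 1 • (a ^ (p - 1) * (FrobeniusTwist.of p (e + 1) A).symm m) := by
      change a ^ (p - 1) * (r ^ p ^ (e + 1) * _) = _
      rw [smul_eq_mul, pow_one, ← pow_mul, ← pow_succ]
      exact mul_left_comm _ _ _
    rw [this, ← FrobeniusTwist.smul_of, map_smul, smul_eq_mul, RingHom.id_apply, ← map_smul,
      FrobeniusTwist.smul_of, smul_eq_mul]
  · change f (FrobeniusTwist.of p e A (s (FrobeniusTwist.of p 1 A (a ^ (p - 1) * a)))) = _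
    have : FrobeniusTwist.of p 1 A (a ^ (p - 1) * a) = a • FrobeniusTwist.of p 1 A 1 := by
      rw [FrobeniusTwist.smul_of, pow_sub_one_mul (Fact.out : p.Prime).ne_zero]
      simp
    rw [this, map_smul, hs]
    simp

/-- Strong `F`-regularity of `A`: for a non-zero-divisor `a`, infinitely many `ᵉa` are sent to `1`
by a linear form. The ideals of values at `ᵉa` increase with `e`, hence become stationary; if they
stayed in a maximal ideal `𝔪`, then `a` would lie in every power of `𝔪`, which Krull's
intersection theorem rules out. -/
theorem exists_frobeniusTwist_linearMap_apply_eq_one [IsNoetherianRing A]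
    (hproj : ∀ e, Module.Projective A (FrobeniusTwist p e A)) {a : A} (ha : a ∈ nonZeroDivisors A)
    (e₁ : ℕ) : ∃ e ≥ e₁, ∃ f : FrobeniusTwist p e A →ₗ[A] A, f (FrobeniusTwist.of p e A a) = 1 := by
  have hmono := frobeniusTraceIdeal_mono (p := p) a
  obtain ⟨n, hn⟩ := monotone_stabilizes_iff_noetherian.mpr ‹IsNoetherianRing A›
    ⟨fun e => frobeniusTraceIdeal p e a, hmono⟩
  suffices h : frobeniusTraceIdeal p n a = ⊤ from
    ⟨max e₁ n, le_max_left _ _, mem_frobeniusTraceIdeal.mp <|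
      hmono (le_max_right e₁ n) (h.ge trivial)⟩
  by_contra h
  obtain ⟨m, hm, hle⟩ := Ideal.exists_le_maximal _ h
  have hmem : a ∈ (⨅ k : ℕ, m ^ k • ⊤ : Submodule A A) := by
    refine Submodule.mem_iInf _ |>.mpr fun k => ?_
    rw [smul_eq_mul, Ideal.mul_top]
    have hk : k ≤ p ^ max k n :=
      (le_max_left k n).trans ((max k n).lt_pow_self (Fact.out : p.Prime).one_lt).le
    refine Ideal.pow_le_pow_right hk (mem_pow_of_frobeniusTraceIdeal_le ?_)
    exact (hn _ (le_max_right k n)).symm.le.trans hle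
  obtain ⟨r, hr⟩ := (Ideal.mem_iInf_smul_pow_eq_bot_iff m a).mp hmem
  have : (1 - (r : A)) * a = 0 := by
    rw [sub_mul, one_mul, sub_eq_zero]
    exact hr.symm
  have h1 := (mul_right_mem_nonZeroDivisors_eq_zero_iff ha).mp this
  exact (Ideal.ne_top_iff_one m).mp hm.ne_top (by rw [sub_eq_zero.mp h1]; exact r.2)

end

/-! ### Bases of `p`-th powers over a field -/

section

variable {p : ℕ} {R K L : Type*} [CommRing R] [Field K] [CommRing L] [Algebra K L] (ι : R →+* L)

variable (p K) in
/-- The `K`-span in `L` of the `p ^ m`-th powers of elements of `R`, along `ι : R → L`. -/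
def powSpan (m : ℕ) : Submodule K L := Submodule.span K (Set.range fun r => ι r ^ p ^ m)

theorem powSpan_antitone : Antitone (powSpan p K ι) := by
  refine antitone_nat_of_succ_le fun m => Submodule.span_le.mpr ?_
  rintro _ ⟨r, rfl⟩
  exact Submodule.subset_span ⟨r ^ p, by simp only [map_pow, ← pow_mul, pow_succ']⟩

theorem exists_linearIndependent_pow [FiniteDimensional K L] (m : ℕ) :
    ∃ (n : ℕ) (r : Fin n → R), LinearIndependent K (fun i => ι (r i) ^ p ^ m) ∧
      powSpan p K ι m ≤ Submodule.span K (Set.range fun i => ι (r i) ^ p ^ m) := by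
  obtain ⟨b, hb, hspan, hli⟩ := exists_linearIndependent K (Set.range fun r => ι r ^ p ^ m)
  have : Fintype b := hli.setFinite.fintype
  choose r hr using hb
  refine ⟨Fintype.card b, fun i => r ((Fintype.equivFin b).symm i).2, ?_, ?_⟩
  · simp only at hr
    simp only [hr]
    exact hli.comp _ (Fintype.equivFin b).symm.injective
  · rw [powSpan, ← hspan]
    refine Submodule.span_mono fun x hx => ⟨Fintype.equivFin b ⟨x, hx⟩, ?_⟩
    simpa using hr hx

variable [Fact p.Prime] [CharP L p]

/-- If `p ^ m`-th powers are combinations of the `r i ^ p ^ m`, raising to the power `p ^ e` shows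
that `p ^ (m + e)`-th powers are combinations of the `r i ^ p ^ (m + e)`. -/
theorem powSpan_add_le {m n : ℕ} {r : Fin n → R}
    (h : powSpan p K ι m ≤ Submodule.span K (Set.range fun i => ι (r i) ^ p ^ m)) (e : ℕ) :
    powSpan p K ι (m + e) ≤ Submodule.span K (Set.range fun i => ι (r i) ^ p ^ (m + e)) := by
  refine Submodule.span_le.mpr ?_
  rintro _ ⟨s, rfl⟩
  obtain ⟨c, hc⟩ := (Submodule.mem_span_range_iff_exists_fun K).mp
    (h (Submodule.subset_span ⟨s, rfl⟩))
  refine (Submodule.mem_span_range_iff_exists_fun K).mpr ⟨fun i => c i ^ p ^ e, ?_⟩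
  simp only at hc ⊢
  rw [pow_add, pow_mul, ← hc, sum_pow_char_pow]
  simp only [smul_pow, ← pow_mul]

/-- Once the decreasing chain of the spans of `p ^ m`-th powers is stationary, a basis consisting
of `p ^ m`-th powers stays a basis of the same space after raising its members to any power
`p ^ e`: the new members still span, and their number is the dimension. This replaces the passage
to a generically étale subalgebra of `R` in the inseparable (or non-reduced) case. -/
theorem exists_forall_linearIndependent_pow [FiniteDimensional K L] :
    ∃ E, ∀ m ≥ E, ∃ (n : ℕ) (r : Fin n → R),
      ∀ e, LinearIndependent K (fun i => ι (r i) ^ p ^ (m + e)) ∧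
        powSpan p K ι m ≤ Submodule.span K (Set.range fun i => ι (r i) ^ p ^ (m + e)) := by
  obtain ⟨E, hE⟩ := monotone_stabilizes_iff_artinian.mpr (inferInstanceAs (IsArtinian K L))
    ⟨fun m => OrderDual.toDual (powSpan p K ι m), fun _ _ h => powSpan_antitone ι h⟩
  replace hE (m) (hm : E ≤ m) : powSpan p K ι E = powSpan p K ι m := hE m hm
  refine ⟨E, fun m hm => ?_⟩
  obtain ⟨n, r, hli, hle⟩ := exists_linearIndependent_pow (p := p) (K := K) ι m
  refine ⟨n, r, fun e => ?_⟩
  have hspan : powSpan p K ι m ≤ Submodule.span K (Set.range fun i => ι (r i) ^ p ^ (m + e)) := by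
    rw [← hE m hm, hE (m + e) (by lia)]
    exact powSpan_add_le ι hle e
  refine ⟨?_, hspan⟩
  rw [linearIndependent_iff_card_le_finrank_span, Set.finrank]
  rw [linearIndependent_iff_card_le_finrank_span, Set.finrank] at hli
  refine hli.trans (Submodule.finrank_mono (le_trans ?_ hspan))
  refine Submodule.span_mono ?_
  rintro _ ⟨i, rfl⟩
  exact ⟨r i, rfl⟩

end

/-! ### Descent from the localization at a minimal prime -/

section

variable {A R : Type*} [CommRing A] [CommRing R] [Algebra A R] (P : Ideal A) [P.IsPrime]
  {K : Type*} [Field K] [Algebra A K] [IsLocalization.AtPrime K P]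

open scoped TensorProduct

theorem exists_notMem_smul_eq_zero_of_one_tmul_eq_zero {y : R} (h : (1 : K) ⊗ₜ[A] y = 0) :
    ∃ s ∉ P, s • y = 0 := by
  have : IsLocalizedModule P.primeCompl (TensorProduct.mk A K R 1) :=
    (isLocalizedModule_iff_isBaseChange P.primeCompl K _).mpr (TensorProduct.isBaseChange A R K)
  obtain ⟨s, hs⟩ := (IsLocalizedModule.eq_zero_iff P.primeCompl (TensorProduct.mk A K R 1)).mp h
  exact ⟨s, s.2, hs⟩

/-- Clearing denominators in a relation over the localization `K` of `A` at `P`. -/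
theorem exists_notMem_smul_mem_span {n : ℕ} {c : Fin n → R} {y : R}
    (h : (1 : K) ⊗ₜ[A] y ∈ Submodule.span K (Set.range fun i => (1 : K) ⊗ₜ[A] c i)) :
    ∃ s ∉ P, s • y ∈ Submodule.span A (Set.range c) := by
  obtain ⟨k, hk⟩ := (Submodule.mem_span_range_iff_exists_fun K).mp h
  obtain ⟨⟨t, ht⟩, hint⟩ := IsLocalization.exist_integer_multiples_of_finite P.primeCompl k
  choose a ha using hint
  have hzero : (1 : K) ⊗ₜ[A] (t • y - ∑ i, a i • c i) = 0 := by
    rw [TensorProduct.tmul_sub, TensorProduct.tmul_sum, TensorProduct.tmul_smul, ← hk,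
      Finset.smul_sum, sub_eq_zero]
    refine Finset.sum_congr rfl fun i _ => ?_
    rw [← smul_assoc]
    change (t • k i) • _ = _
    rw [show t • k i = algebraMap A K (a i) from (ha i).symm, TensorProduct.tmul_smul,
      algebraMap_smul]
  obtain ⟨s, hs, hs0⟩ := exists_notMem_smul_eq_zero_of_one_tmul_eq_zero P hzero
  refine ⟨s * t, P.primeCompl.mul_mem hs ht, ?_⟩
  rw [smul_sub, sub_eq_zero] at hs0
  rw [mul_smul, hs0]
  exact Submodule.smul_mem _ _ (sum_mem fun i _ =>
    Submodule.smul_mem _ _ (Submodule.subset_span ⟨i, rfl⟩))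

theorem exists_notMem_forall_smul_mem_span [IsNoetherian A R] {n : ℕ} {c : Fin n → R} {S : Set R}
    (h : ∀ y ∈ S, (1 : K) ⊗ₜ[A] y ∈ Submodule.span K (Set.range fun i => (1 : K) ⊗ₜ[A] c i)) :
    ∃ s ∉ P, ∀ y ∈ S, s • y ∈ Submodule.span A (Set.range c) := by
  classical
  obtain ⟨T, hTS, hT⟩ := (Submodule.fg_span_iff_fg_span_finset_subset S).mp
    (IsNoetherian.noetherian (Submodule.span A S))
  choose s hsP hs using fun y : T => exists_notMem_smul_mem_span P (h y (hTS y.2))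
  refine ⟨∏ y, s y, prod_mem (S := P.primeCompl) fun y _ => hsP y, fun y hy => ?_⟩
  have hle : Submodule.span A (T : Set R) ≤
      (Submodule.span A (Set.range c)).comap (LinearMap.lsmul A R (∏ y, s y)) := by
    refine Submodule.span_le.mpr fun z hz => ?_
    rw [SetLike.mem_coe, Submodule.mem_comap, LinearMap.lsmul_apply]
    rw [← Finset.prod_erase_mul _ _ (Finset.mem_univ ⟨z, hz⟩), mul_smul]
    exact Submodule.smul_mem _ _ (hs ⟨z, hz⟩)
  exact hle (hT.le (Submodule.subset_span hy))

theorem mem_of_sum_smul_eq_zero {n : ℕ} {c : Fin n → R}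
    (h : LinearIndependent K fun i => (1 : K) ⊗ₜ[A] c i) {a : Fin n → A} (ha : ∑ i, a i • c i = 0)
    (i : Fin n) : a i ∈ P := by
  have h0 := Fintype.linearIndependent_iff.mp h (fun i => algebraMap A K (a i)) (by
    simp only [algebraMap_smul, ← TensorProduct.tmul_smul]
    rw [← TensorProduct.tmul_sum, ha, TensorProduct.tmul_zero]) i
  by_contra hi
  exact (IsLocalization.map_units K (⟨a i, hi⟩ : P.primeCompl)).ne_zero h0

end

section

variable {A : Type*} [CommRing A] [IsReduced A]

theorem sInf_minimalPrimes_eq_bot : sInf (minimalPrimes A) = ⊥ := by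
  rw [minimalPrimes, Ideal.sInf_minimalPrimes]
  exact nilradical_eq_zero A

theorem mem_nonZeroDivisors_of_forall_notMem_minimalPrimes {x : A}
    (h : ∀ P ∈ minimalPrimes A, x ∉ P) : x ∈ nonZeroDivisors A := by
  rw [mem_nonZeroDivisors_iff_right]
  intro y hy
  rw [← Ideal.mem_bot, ← sInf_minimalPrimes_eq_bot, Submodule.mem_sInf]
  intro P hP
  have hPp : Ideal.IsPrime P := hP.1.1
  exact (hPp.mem_or_mem (hy ▸ P.zero_mem : y * x ∈ P)).resolve_right (h P hP)

theorem Ideal.exists_mem_nonZeroDivisors_of_forall_not_le [IsNoetherianRing A] {I : Ideal A}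
    (h : ∀ P ∈ minimalPrimes A, ¬ I ≤ P) : ∃ x ∈ I, x ∈ nonZeroDivisors A := by
  by_contra! H
  have hfin := minimalPrimes.finite_of_isNoetherianRing A
  have hcov : (I : Set A) ⊆ ⋃ P ∈ (hfin.toFinset : Set (Ideal A)), (id P : Ideal A) := by
    intro x hx
    by_contra hx'
    refine H x hx (mem_nonZeroDivisors_of_forall_notMem_minimalPrimes fun P hP hxP => hx' ?_)
    exact Set.mem_biUnion (by simpa using hP) hxP
  rw [Ideal.subset_union_prime (f := id) ⊥ ⊥ fun P hP _ _ => (hfin.mem_toFinset.mp hP).1.1] at hcov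
  obtain ⟨P, hP, hle⟩ := hcov
  exact h P (hfin.mem_toFinset.mp hP) hle

end

section

universe u

open scoped TensorProduct

/-- An element of all other minimal primes outside `P` annihilates `P`. -/
theorem exists_notMem_forall_mul_eq_zero_of_mem_minimalPrimes {A : Type*} [CommRing A]
    [IsNoetherianRing A] [IsReduced A] {P : Ideal A} (hP : P ∈ minimalPrimes A) :
    ∃ ε ∉ P, ∀ a ∈ P, ε * a = 0 := by
  classical
  have hPp : P.IsPrime := hP.1.1
  have hfin := minimalPrimes.finite_of_isNoetherianRing A
  have hnle : ¬ ((hfin.toFinset.erase P).inf id ≤ P) := by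
    rw [hPp.inf_le']
    rintro ⟨Q, hQ, hle⟩
    rw [Finset.mem_erase, Set.Finite.mem_toFinset] at hQ
    exact hQ.1 (le_antisymm hle (hP.2 hQ.2.1 hle))
  obtain ⟨ε, hε, hεP⟩ := SetLike.not_le_iff_exists.mp hnle
  refine ⟨ε, hεP, fun a ha => ?_⟩
  have : ε * a ∈ sInf (minimalPrimes A) := by
    refine (Submodule.mem_sInf).mpr fun Q hQ => ?_
    by_cases hQP : Q = P
    · exact hQP ▸ Ideal.mul_mem_left _ _ ha
    · exact Ideal.mul_mem_right _ _ (Submodule.mem_finsetInf.mp hε Q (by simp [hQP, hQ]))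
  rwa [sInf_minimalPrimes_eq_bot] at this

/-- A prime annihilated by an element outside it becomes zero in the localization at it, which is
therefore a field. -/
theorem exists_field_isLocalizationAtPrime {A : Type u} [CommRing A] {P : Ideal A}
    [P.IsPrime] {ε : A} (hε : ε ∉ P) (hεP : ∀ a ∈ P, ε * a = 0) :
    ∃ (K : Type u) (_ : Field K) (_ : Algebra A K), IsLocalization.AtPrime K P := by
  suffices h : IsField (Localization.AtPrime P) from
    ⟨Localization.AtPrime P, h.toField, inferInstance, inferInstance⟩
  rw [IsLocalRing.isField_iff_maximalIdeal_eq, ← Localization.AtPrime.map_eq_maximalIdeal,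
    eq_bot_iff, Ideal.map_le_iff_le_comap]
  exact fun a ha => (IsLocalization.map_eq_zero_iff P.primeCompl _ a).mpr ⟨⟨ε, hε⟩, hεP a ha⟩

section

variable {A R : Type*} [CommRing A] [IsNoetherianRing A] [CommRing R] [Algebra A R]
  [Module.Finite A R] {P : Ideal A} [P.IsPrime] {ε : A}

/-- A basis of the localization of `R` at the minimal prime `P` consisting of elements of `R`,
with a common denominator `s` for the coordinates of all elements of `R`. -/
theorem exists_independent_family_forall_smul_mem_span (hε : ε ∉ P) (hεP : ∀ a ∈ P, ε * a = 0) :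
    ∃ (n : ℕ) (b : Fin n → R), (∃ s ∉ P, ∀ y : R, s • y ∈ Submodule.span A (Set.range b)) ∧
      ∀ a : Fin n → A, ∑ i, a i • b i = 0 → ∀ i, a i ∈ P := by
  obtain ⟨K, _, _, _⟩ := exists_field_isLocalizationAtPrime hε hεP
  let ι : R →+* K ⊗[A] R := (Algebra.TensorProduct.includeRight : R →ₐ[A] K ⊗[A] R).toRingHom
  have hι (y : R) : ι y = (1 : K) ⊗ₜ[A] y := rfl
  -- With base `1` in place of `p` and `m = 0`, the powers are the elements themselves.
  obtain ⟨n, b, hli, hle⟩ := exists_linearIndependent_pow (p := 1) (K := K) ι 0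
  simp only [pow_zero, pow_one] at hli hle
  refine ⟨n, b, ?_, fun a ha i => mem_of_sum_smul_eq_zero P hli ha i⟩
  obtain ⟨s, hs, h⟩ := exists_notMem_forall_smul_mem_span P (K := K) (c := b) (S := Set.univ)
    fun y _ => hle (Submodule.subset_span ⟨y, by simp [hι]⟩)
  exact ⟨s, hs, fun y => h y trivial⟩

variable {p : ℕ} [Fact p.Prime] [CharP R p]

/-- For `m` large, a family `r i ^ p ^ m` that is a basis of the span of the `p ^ m`-th powers in
the localization of `R` at the minimal prime `P`, remains so after raising to any power `p ^ e`,
and has a common denominator `s` for `e = 0` and `e = 1`. -/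
theorem exists_forall_independent_family_pow (hinj : Function.Injective (algebraMap A R))
    (hε : ε ∉ P) (hεP : ∀ a ∈ P, ε * a = 0) :
    ∃ E, ∀ m ≥ E, ∃ (n : ℕ) (r : Fin n → R),
      (∃ s ∉ P, ∀ y : R, s • y ^ p ^ m ∈ Submodule.span A (Set.range fun i => r i ^ p ^ m) ∧
        s • y ^ p ^ m ∈ Submodule.span A (Set.range fun i => r i ^ p ^ (m + 1))) ∧
      ∀ (e : ℕ) (a : Fin n → A), ∑ i, a i • r i ^ p ^ (m + e) = 0 → ∀ i, a i ∈ P := by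
  obtain ⟨K, _, _, _⟩ := exists_field_isLocalizationAtPrime hε hεP
  let ι : R →+* K ⊗[A] R := (Algebra.TensorProduct.includeRight : R →ₐ[A] K ⊗[A] R).toRingHom
  have hιpow (y : R) (k : ℕ) : ι y ^ k = (1 : K) ⊗ₜ[A] (y ^ k) := (map_pow ι y k).symm
  have hnt : Nontrivial (K ⊗[A] R) := by
    refine ⟨⟨ι 1, 0, fun h => ?_⟩⟩
    obtain ⟨s, hs, hs0⟩ := exists_notMem_smul_eq_zero_of_one_tmul_eq_zero P h
    rw [← Algebra.algebraMap_eq_smul_one, map_eq_zero_iff _ hinj] at hs0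
    exact hs (hs0 ▸ P.zero_mem)
  have : CharP (K ⊗[A] R) p := by
    refine (CharP.charP_iff_prime_eq_zero (Fact.out : p.Prime)).mpr ?_
    rw [← map_natCast ι, CharP.cast_eq_zero, map_zero]
  obtain ⟨E, hE⟩ := exists_forall_linearIndependent_pow (p := p) (K := K) ι
  refine ⟨E, fun m hm => ?_⟩
  obtain ⟨n, r, h⟩ := hE m hm
  simp only [hιpow] at h
  have key (e : ℕ) : ∃ s ∉ P, ∀ y ∈ Set.range fun y : R => y ^ p ^ m,
      s • y ∈ Submodule.span A (Set.range fun i => r i ^ p ^ (m + e)) := by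
    refine exists_notMem_forall_smul_mem_span P (K := K) ?_
    rintro _ ⟨y, rfl⟩
    exact (h e).2 (Submodule.subset_span ⟨y, by simp only [hιpow]⟩)
  obtain ⟨s₀, hs₀, h₀⟩ := key 0
  obtain ⟨s₁, hs₁, h₁⟩ := key 1
  refine ⟨n, r, ⟨s₀ * s₁, P.primeCompl.mul_mem hs₀ hs₁, fun y => ⟨?_, ?_⟩⟩,
    fun e a ha i => mem_of_sum_smul_eq_zero P (h e).1 ha i⟩
  · rw [mul_comm, mul_smul]
    exact Submodule.smul_mem _ _ (h₀ _ ⟨y, rfl⟩)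
  · rw [mul_smul]
    exact Submodule.smul_mem _ _ (h₁ _ ⟨y, rfl⟩)

end

end

/-! ### Transfer of linear forms from `ᵉA` to `ᵉR` -/

section

variable (p : ℕ) [Fact p.Prime] (A : Type*) [CommRing A] [CharP A p] (R : Type*) [CommRing R]
  [Algebra A R]

/-- The ideal of all `d` in `A` by which linear forms on twists of `A` can be transferred to `R`:
each `A`-linear `f : ᵉA → A` gives rise to an `R`-linear `θ : ᵉR → ᵐR` with
`θ (ᵉa) = ᵐ(d * f (ᵉ(a ^ p ^ m)))` for `a` in `A`. The map `θ` is encoded as an additive map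
`R → R` that is linear in the sense of the twisted actions. The point is that `d` and `m` are
independent of `e` and `f`. -/
def frobeniusTransferIdeal (m : ℕ) : Ideal A where
  carrier := {d | ∀ (e : ℕ) (f : FrobeniusTwist p e A →ₗ[A] A), ∃ θ : R →+ R,
    (∀ t y, θ (t ^ p ^ e * y) = t ^ p ^ m * θ y) ∧
      ∀ a, θ (algebraMap A R a) = algebraMap A R (d * f (FrobeniusTwist.of p e A (a ^ p ^ m)))}
  add_mem' := fun {c d} hc hd e f => by
    obtain ⟨θ, hθ, hθ'⟩ := hc e f
    obtain ⟨η, hη, hη'⟩ := hd e f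
    refine ⟨θ + η, fun t y => ?_, fun a => ?_⟩
    · rw [AddMonoidHom.add_apply, AddMonoidHom.add_apply, hθ, hη, mul_add]
    · rw [AddMonoidHom.add_apply, hθ', hη', add_mul, map_add]
  zero_mem' := fun e f => ⟨0, by simp, by simp⟩
  smul_mem' := fun c d hd e f => by
    obtain ⟨θ, hθ, hθ'⟩ := hd e f
    refine ⟨(AddMonoidHom.mulLeft (algebraMap A R c)).comp θ, fun t y => ?_, fun a => ?_⟩
    · simp only [AddMonoidHom.comp_apply, AddMonoidHom.coe_mulLeft, hθ]
      ring
    · simp only [AddMonoidHom.comp_apply, AddMonoidHom.coe_mulLeft, hθ', ← map_mul, smul_eq_mul,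
        mul_assoc]

end

section

variable {A R : Type*} [CommRing A] [CommRing R] [Algebra A R] {P : Ideal A} {ε : A}

/-- The denominator `s` for one step of Frobenius gives the denominator
`s ^ (2 * p ^ e) = (s ^ 2) ^ p ^ e` for `e` steps, because `1 + 1 / p + 1 / p ^ 2 + ⋯ ≤ 2`. As an
element acting on the twist `ᵉR`, it is `s ^ 2`, independently of `e`. -/
theorem smul_pow_mem_span {p : ℕ} [Fact p.Prime] [CharP R p] {n m : ℕ} {r : Fin n → R} {s : A}
    (h₀ : ∀ y : R, s • y ^ p ^ m ∈ Submodule.span A (Set.range fun i => r i ^ p ^ m))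
    (h₁ : ∀ y : R, s • y ^ p ^ m ∈ Submodule.span A (Set.range fun i => r i ^ p ^ (m + 1)))
    (e : ℕ) (y : R) :
    s ^ (2 * p ^ e) • y ^ p ^ m ∈ Submodule.span A (Set.range fun i => r i ^ p ^ (m + e)) := by
  induction e with
  | zero =>
    rw [pow_zero, mul_one, pow_two, mul_smul]
    exact Submodule.smul_mem _ _ (h₀ y)
  | succ e ih =>
    have hstep (i : Fin n) : s ^ p ^ e • r i ^ p ^ (m + e) ∈
        Submodule.span A (Set.range fun i => r i ^ p ^ (m + (e + 1))) := by
      obtain ⟨c, hc⟩ := (Submodule.mem_span_range_iff_exists_fun A).mp (h₁ (r i))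
      rw [pow_add p m e, pow_mul, ← smul_pow, ← hc, sum_pow_char_pow]
      refine sum_mem fun j _ => ?_
      rw [smul_pow, ← pow_mul, ← pow_add]
      exact Submodule.smul_mem _ _
        (Submodule.subset_span ⟨j, by simp only [add_assoc, add_comm e 1]⟩)
    obtain ⟨c, hc⟩ := (Submodule.mem_span_range_iff_exists_fun A).mp ih
    -- `2 * p ^ e + p ^ e ≤ 2 * p ^ (e + 1)`, because `3 ≤ 2 * p`.
    have hexp : 2 * p ^ (e + 1) = (2 * p ^ (e + 1) - 3 * p ^ e) + p ^ e + 2 * p ^ e := by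
      have : 2 * p ^ e ≤ p * p ^ e := Nat.mul_le_mul_right _ (Fact.out : p.Prime).two_le
      rw [pow_succ']
      lia
    rw [hexp, pow_add s, mul_smul, ← hc, pow_add s, mul_smul, Finset.smul_sum]
    refine Submodule.smul_mem _ _ (sum_mem fun i _ => ?_)
    rw [smul_comm]
    exact Submodule.smul_mem _ _ (hstep i)

/-- Coefficients with respect to a family independent modulo `P` are unique up to `P`, hence
unique after multiplication by an `ε` that annihilates `P`. -/
theorem mul_eq_mul_of_sum_smul_eq {n : ℕ} {c : Fin n → R} (hεP : ∀ a ∈ P, ε * a = 0)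
    (hc : ∀ a : Fin n → A, ∑ i, a i • c i = 0 → ∀ i, a i ∈ P) {a b : Fin n → A}
    (h : ∑ i, a i • c i = ∑ i, b i • c i) (i : Fin n) : ε * a i = ε * b i := by
  rw [← sub_eq_zero, ← mul_sub]
  refine hεP _ (hc (fun i => a i - b i) ?_ i)
  simp only [sub_smul, Finset.sum_sub_distrib, h, sub_self]

variable {p : ℕ} [Fact p.Prime] [CharP A p] [CharP R p]

/-- If `s ^ (2 * p ^ e) • y ^ p ^ m = ∑ αᵢ • rᵢ ^ p ^ (m + e)`, then the transferred map is
`θ y = s • ∑ (ε * f (ᵉαᵢ)) • rᵢ ^ p ^ m`. The factor `ε` makes it independent of the choice of the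
`αᵢ`, and the factor `s` makes it `R`-linear, not only up to torsion. -/
theorem mul_pow_mem_frobeniusTransferIdeal {n m : ℕ} {r : Fin n → R} {s : A}
    (hεP : ∀ a ∈ P, ε * a = 0)
    (h₀ : ∀ y : R, s • y ^ p ^ m ∈ Submodule.span A (Set.range fun i => r i ^ p ^ m))
    (h₁ : ∀ y : R, s • y ^ p ^ m ∈ Submodule.span A (Set.range fun i => r i ^ p ^ (m + 1)))
    (hind : ∀ (e : ℕ) (a : Fin n → A), ∑ i, a i • r i ^ p ^ (m + e) = 0 → ∀ i, a i ∈ P) :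
    ε * s ^ 3 ∈ frobeniusTransferIdeal p A R m := by
  intro e f
  have hf (b a : A) : f (FrobeniusTwist.of p e A (b ^ p ^ e * a)) =
      b * f (FrobeniusTwist.of p e A a) := by
    rw [← smul_eq_mul, ← FrobeniusTwist.smul_of, map_smul, smul_eq_mul]
  have hwd {a b : Fin n → A} (h : ∑ i, a i • r i ^ p ^ (m + e) = ∑ i, b i • r i ^ p ^ (m + e))
      (i : Fin n) :
      ε * f (FrobeniusTwist.of p e A (a i)) = ε * f (FrobeniusTwist.of p e A (b i)) := by
    have := mul_eq_mul_of_sum_smul_eq hεP (hind e) h i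
    have hq : p ^ e = p ^ e - 1 + 1 :=
      (Nat.sub_add_cancel (Nat.one_le_pow _ _ (Fact.out : p.Prime).pos)).symm
    rw [← hf, ← hf, hq, pow_succ, mul_assoc, this, mul_assoc]
  choose α hα using fun y : R => (Submodule.mem_span_range_iff_exists_fun A).mp
    (smul_pow_mem_span h₀ h₁ e y)
  obtain ⟨β, hβ⟩ := (Submodule.mem_span_range_iff_exists_fun A).mp (h₀ 1)
  -- The matrix of multiplication by `t ^ p ^ m` on the span of the `r i ^ p ^ m`, up to `s`.
  choose ρ hρ using fun (t : R) (i : Fin n) =>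
    (Submodule.mem_span_range_iff_exists_fun A).mp (h₀ (t * r i))
  have hpow (c : Fin n → A) : (∑ i, c i • r i ^ p ^ m) ^ p ^ e =
      ∑ i, c i ^ p ^ e • r i ^ p ^ (m + e) := by
    simp only [sum_pow_char_pow, smul_pow, ← pow_mul, ← pow_add]
  let θ : R →+ R :=
    { toFun := fun y => s • ∑ i, (ε * f (FrobeniusTwist.of p e A (α y i))) • r i ^ p ^ m
      map_zero' := by
        have := hwd (a := α 0) (b := 0) (by
          simp [hα, zero_pow (pow_ne_zero m (Fact.out : p.Prime).ne_zero)])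
        simp [this]
      map_add' := fun y z => by
        have := hwd (a := α (y + z)) (b := α y + α z) (by
          simp only [Pi.add_apply, add_smul, Finset.sum_add_distrib, hα, add_pow_char_pow,
            smul_add])
        simp only [this, Pi.add_apply, map_add, mul_add, add_smul, Finset.sum_add_distrib,
          smul_add] }
  -- The factor `s` outside becomes `s ^ p ^ e` inside `f`.
  have hθ (y : R) :
      θ y = ∑ i, (ε * f (FrobeniusTwist.of p e A (s ^ p ^ e * α y i))) • r i ^ p ^ m := by
    change s • ∑ i, (ε * f (FrobeniusTwist.of p e A (α y i))) • r i ^ p ^ m = _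
    simp only [Finset.smul_sum, hf, smul_smul, mul_left_comm]
  refine ⟨θ, fun t y => ?_, fun a => ?_⟩
  · have hα' := hwd (a := fun j => s ^ p ^ e * α (t ^ p ^ e * y) j)
      (b := fun j => ∑ i, ρ t i j ^ p ^ e * α y i) (by
        simp only [mul_smul, ← Finset.smul_sum, hα, Finset.sum_smul]
        rw [Finset.sum_comm]
        have (i : Fin n) : ∑ j, ρ t i j ^ p ^ e • α y i • r j ^ p ^ (m + e) =
            α y i • (s ^ p ^ e • (t ^ p ^ m) ^ p ^ e * r i ^ p ^ (m + e)) := by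
          simp only [smul_comm _ (α y i), ← Finset.smul_sum]
          rw [← hpow, hρ, smul_pow, mul_pow, mul_pow, ← pow_mul, ← pow_mul, ← pow_add,
            smul_mul_assoc]
        simp only [this, ← mul_smul_comm, ← Finset.mul_sum, hα]
        rw [mul_pow, ← pow_mul, ← pow_mul, mul_comm (p ^ e), smul_mul_assoc, mul_smul_comm])
    rw [hθ]
    simp only [hα']
    simp only [map_sum, hf, Finset.mul_sum, Finset.sum_smul]
    rw [Finset.sum_comm]
    change _ = t ^ p ^ m * s • ∑ i, (ε * f (FrobeniusTwist.of p e A (α y i))) • r i ^ p ^ m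
    rw [mul_smul_comm, ← smul_mul_assoc, Finset.mul_sum]
    refine Finset.sum_congr rfl fun i _ => ?_
    rw [mul_smul_comm, smul_mul_assoc, ← mul_pow, ← hρ, Finset.smul_sum]
    refine Finset.sum_congr rfl fun j _ => ?_
    rw [smul_smul]
    congr 1
    ring
  · have hα' := hwd (a := fun j => s ^ p ^ e * α (algebraMap A R a) j)
      (b := fun j => (s ^ 2 * β j) ^ p ^ e * a ^ p ^ m) (by
        simp only [mul_pow, mul_assoc, mul_smul, ← Finset.smul_sum, hα]
        simp only [smul_comm _ (a ^ p ^ m), ← Finset.smul_sum, ← hpow, hβ]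
        rw [one_pow, smul_pow, one_pow, ← map_pow, Algebra.algebraMap_eq_smul_one,
          pow_mul]
        simp only [smul_smul]
        congr 1
        ring)
    rw [hθ]
    simp only [hα']
    simp only [hf]
    have (i : Fin n) : (ε * (s ^ 2 * β i * f (FrobeniusTwist.of p e A (a ^ p ^ m)))) • r i ^ p ^ m =
        (ε * s ^ 2 * f (FrobeniusTwist.of p e A (a ^ p ^ m))) • β i • r i ^ p ^ m := by
      rw [smul_smul]
      congr 1
      ring
    simp only [this]
    rw [← Finset.smul_sum, hβ, one_pow, smul_smul, Algebra.algebraMap_eq_smul_one]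
    congr 1
    ring

end

/-! ### Non-zero-divisors of `A` and elements of `R` off the minimal primes -/

section

variable {A R : Type*} [CommRing A] [CommRing R] [Algebra A R]

theorem algebraMap_mem_offMinimalPrimes [Module.IsTorsionFree A R] {a : A}
    (ha : a ∈ nonZeroDivisors A) : algebraMap A R a ∈ offMinimalPrimes R := by
  intro P hP hmem
  refine Set.disjoint_left.mp (Ideal.disjoint_nonZeroDivisors_of_mem_minimalPrimes hP) hmem ?_
  have hreg : IsSMulRegular R a :=
    Module.IsTorsionFree.isSMulRegular (isRegular_iff_mem_nonZeroDivisors.mpr ha)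
  refine mem_nonZeroDivisors_iff_right.mpr fun y hy => hreg ?_
  simpa [Algebra.smul_def, mul_comm] using hy

/-- Otherwise the contraction of `(c)` lies in a minimal prime of `A`, and a prime of `R` over it
that contains `c` is minimal by incomparability. -/
theorem exists_mem_nonZeroDivisors_algebraMap_eq_mul [IsNoetherianRing A] [IsReduced A]
    [Algebra.IsIntegral A R] {c : R} (hc : c ∈ offMinimalPrimes R) :
    ∃ a ∈ nonZeroDivisors A, ∃ r, algebraMap A R a = c * r := by
  suffices h : ∀ P ∈ minimalPrimes A, ¬ (Ideal.span {c}).comap (algebraMap A R) ≤ P by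
    obtain ⟨a, ha, hreg⟩ := Ideal.exists_mem_nonZeroDivisors_of_forall_not_le h
    obtain ⟨r, hr⟩ := Ideal.mem_span_singleton'.mp ha
    exact ⟨a, hreg, r, by rw [← hr, mul_comm]⟩
  intro P hP hle
  have hPp : P.IsPrime := hP.1.1
  obtain ⟨Q, hQc, hQ, hQP⟩ := Ideal.exists_ideal_over_prime_of_isIntegral P _ hle
  refine hc Q ⟨⟨hQ, bot_le⟩, fun Q' hQ' hQ'Q => ?_⟩ (hQc (Ideal.mem_span_singleton_self c))
  have hQ'p : Q'.IsPrime := hQ'.1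
  by_contra hlt
  have hcomap := Ideal.IsIntegral.comap_lt_comap (R := A) (lt_of_le_not_ge hQ'Q hlt)
  rw [hQP] at hcomap
  exact absurd (hP.2 ⟨hQ'p.comap _, bot_le⟩ hcomap.le) (not_le_of_gt hcomap)

end

/-! ### Transfer ideals and maps of finite rank -/

section

variable {A R : Type*} [CommRing A] [IsNoetherianRing A] [IsReduced A] [CommRing R] [Algebra A R]
  [Module.Finite A R]

/-- The exponent `m` is chosen large enough for all of the finitely many minimal primes of `A` at
once; the transfer ideal is then in none of them. -/
theorem exists_mem_nonZeroDivisors_mem_frobeniusTransferIdeal {p : ℕ} [Fact p.Prime] [CharP A p]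
    [CharP R p] (hinj : Function.Injective (algebraMap A R)) :
    ∃ m, ∃ d ∈ frobeniusTransferIdeal p A R m, d ∈ nonZeroDivisors A := by
  have hloc (P : minimalPrimes A) : ∃ E, ∀ m ≥ E, ¬ frobeniusTransferIdeal p A R m ≤ P := by
    obtain ⟨P, hP⟩ := P
    have hPp : P.IsPrime := hP.1.1
    obtain ⟨ε, hε, hεP⟩ := exists_notMem_forall_mul_eq_zero_of_mem_minimalPrimes hP
    obtain ⟨E, hE⟩ := exists_forall_independent_family_pow (p := p) (R := R) hinj hε hεP
    refine ⟨E, fun m hm hle => ?_⟩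
    obtain ⟨n, r, ⟨s, hs, hspan⟩, hind⟩ := hE m hm
    have := hle (mul_pow_mem_frobeniusTransferIdeal hεP (fun y => (hspan y).1)
      (fun y => (hspan y).2) hind)
    rcases hPp.mem_or_mem this with h | h
    exacts [hε h, hs (hPp.mem_of_pow_mem _ h)]
  choose E hE using hloc
  have := (minimalPrimes.finite_of_isNoetherianRing A).to_subtype
  obtain ⟨m, hm⟩ := Set.Finite.bddAbove (Set.finite_range E)
  exact ⟨m, Ideal.exists_mem_nonZeroDivisors_of_forall_not_le fun P hP =>
    hE ⟨P, hP⟩ m (hm ⟨_, rfl⟩)⟩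

variable (A R) in
/-- The `A`-linear endomorphisms of `R` that are sums of maps `y ↦ φ y • b` with `φ` an `A`-linear
form on `R` and `b` in `R`; equivalently, those that factor through a finite free module. -/
def rankOneSpan : Submodule A (Module.End A R) :=
  Submodule.span A (Set.range fun x : (R →ₗ[A] A) × R => x.1.smulRight x.2)

/-- Multiplication by some non-zero-divisor of `A` factors through a finite free `A`-module, since
`R` is free at the minimal primes of `A`. -/
theorem exists_mem_nonZeroDivisors_algebraMap_mem_rankOneSpan :
    ∃ c ∈ nonZeroDivisors A, algebraMap A (Module.End A R) c ∈ rankOneSpan A R := by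
  suffices h : ∀ P ∈ minimalPrimes A,
      ¬ (rankOneSpan A R).comap (Algebra.linearMap A (Module.End A R)) ≤ P by
    obtain ⟨c, hc, hreg⟩ := Ideal.exists_mem_nonZeroDivisors_of_forall_not_le h
    exact ⟨c, hreg, hc⟩
  intro P hP hle
  have hPp : P.IsPrime := hP.1.1
  obtain ⟨ε, hε, hεP⟩ := exists_notMem_forall_mul_eq_zero_of_mem_minimalPrimes hP
  obtain ⟨n, b, ⟨s, hs, hspan⟩, hind⟩ :=
    exists_independent_family_forall_smul_mem_span (R := R) hε hεP
  choose α hα using fun y : R => (Submodule.mem_span_range_iff_exists_fun A).mp (hspan y)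
  let φ (i : Fin n) : R →ₗ[A] A :=
    { toFun := fun y => ε * α y i
      map_add' := fun y z => by
        rw [mul_eq_mul_of_sum_smul_eq hεP hind (a := α (y + z)) (b := α y + α z) (by
          simp only [Pi.add_apply, add_smul, Finset.sum_add_distrib, hα, smul_add])]
        exact mul_add _ _ _
      map_smul' := fun a y => by
        rw [mul_eq_mul_of_sum_smul_eq hεP hind (a := α (a • y)) (b := a • α y) (by
          simp only [Pi.smul_apply, smul_assoc, ← Finset.smul_sum, hα, smul_comm a s])]
        exact mul_left_comm _ _ _ }
  have hmem : algebraMap A (Module.End A R) (ε * s) ∈ rankOneSpan A R := by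
    have : algebraMap A (Module.End A R) (ε * s) = ∑ i, (φ i).smulRight (b i) := by
      ext y
      simp only [Module.algebraMap_end_apply, LinearMap.sum_apply, LinearMap.smulRight_apply]
      rw [mul_smul, ← hα, Finset.smul_sum]
      simp only [smul_smul]
      rfl
    rw [this]
    exact sum_mem fun i _ => Submodule.subset_span ⟨(φ i, b i), rfl⟩
  rcases hPp.mem_or_mem (hle hmem) with h | h
  exacts [hε h, hs h]

end

section

variable {p : ℕ} [Fact p.Prime] {A R : Type*} [CommRing A] [CharP A p] [CommRing R]
  [Algebra A R]

/-- Linear maps out of `ᵉR` need not lift along a surjection, for `ᵉR` need not be projective.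
They do after composition with `ᵉu` if `u` factors through a finite free module, because `ᵉA` is
projective. -/
theorem exists_lift_of_mem_rankOneSpan {e : ℕ} [Module.Projective A (FrobeniusTwist p e A)]
    {M N : Type*} [AddCommGroup M] [Module A M] [AddCommGroup N] [Module A N] {π : M →ₗ[A] N}
    (hπ : Function.Surjective π) {u : Module.End A R} (hu : u ∈ rankOneSpan A R)
    (h : FrobeniusTwist p e R →ₗ[A] N) :
    ∃ k : FrobeniusTwist p e R →ₗ[A] M, ∀ y,
      π (k (FrobeniusTwist.of p e R y)) = h (FrobeniusTwist.of p e R (u y)) := by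
  induction hu using Submodule.span_induction generalizing h with
  | mem u hu =>
    obtain ⟨⟨φ, b⟩, rfl⟩ := hu
    let h' : FrobeniusTwist p e A →ₗ[A] N :=
      { toFun := fun a => h (FrobeniusTwist.of p e R ((FrobeniusTwist.of p e A).symm a • b))
        map_add' := fun a a' => by simp only [map_add, add_smul]
        map_smul' := fun c a => by
          rw [RingHom.id_apply, ← map_smul, FrobeniusTwist.smul_of, smul_smul]
          rfl }
    obtain ⟨k, hk⟩ := Module.projective_lifting_property π h' hπ
    refine ⟨{ toFun := fun y => k (FrobeniusTwist.of p e A (φ ((FrobeniusTwist.of p e R).symm y)))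
              map_add' := fun y z => by simp only [map_add]
              map_smul' := fun c y => ?_ }, fun y => ?_⟩
    · rw [RingHom.id_apply, ← map_smul, FrobeniusTwist.smul_of, ← map_smul]
      rfl
    · exact LinearMap.congr_fun hk (FrobeniusTwist.of p e A (φ y))
  | zero => exact ⟨0, by simp⟩
  | add u v _ _ hu hv =>
    obtain ⟨k, hk⟩ := hu h
    obtain ⟨l, hl⟩ := hv h
    exact ⟨k + l, fun y => by
      rw [LinearMap.add_apply, map_add, hk, hl, LinearMap.add_apply, map_add, map_add]⟩
  | smul a u _ hu =>
    obtain ⟨k, hk⟩ := hu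
      { toFun := fun y => h (FrobeniusTwist.of p e R (a • (FrobeniusTwist.of p e R).symm y))
        map_add' := fun y z => by simp only [map_add, smul_add]
        map_smul' := fun c y => by
          obtain ⟨y, rfl⟩ := (FrobeniusTwist.of p e R).surjective y
          rw [FrobeniusTwist.smul_of]
          simp only [AddEquiv.symm_apply_apply]
          rw [smul_comm a, ← FrobeniusTwist.smul_of, map_smul, RingHom.id_apply] }
    exact ⟨k, hk⟩

end

/-! ### Tight interiors and test elements -/

section

variable {p : ℕ} [Fact p.Prime] {R : Type*} [CommRing R] [CharP R p]

theorem mem_tightInteriorAt_of_linearMap {N : Type*} [AddCommGroup N] [Module R N] {e₀ e : ℕ}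
    (he : e₀ ≤ e) (c : R) (g : FrobeniusTwist p e R →ₗ[R] N) :
    g (FrobeniusTwist.of p e R c) ∈ tightInteriorAt p R N c e₀ :=
  Submodule.mem_iSup_of_mem e (Submodule.mem_iSup_of_mem he ⟨g, rfl⟩)

theorem tightInteriorAt_le {N : Type*} [AddCommGroup N] [Module R N] {c : R} {e₀ : ℕ}
    {N' : Submodule R N}
    (h : ∀ e ≥ e₀, ∀ g : FrobeniusTwist p e R →ₗ[R] N, g (FrobeniusTwist.of p e R c) ∈ N') :
    tightInteriorAt p R N c e₀ ≤ N' := by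
  refine iSup₂_le fun e he => ?_
  rintro _ ⟨g, rfl⟩
  exact h e he g

theorem mem_tightInterior {N : Type*} [AddCommGroup N] [Module R N] {x : N} :
    x ∈ tightInterior p R N ↔
      ∀ c ∈ offMinimalPrimes R, ∀ e₀, x ∈ tightInteriorAt p R N c e₀ := by
  simp [tightInterior, Submodule.mem_iInf]

theorem map_tightInterior_le {N N' : Type*} [AddCommGroup N] [Module R N] [AddCommGroup N']
    [Module R N'] (f : N →ₗ[R] N') :
    (tightInterior p R N).map f ≤ tightInterior p R N' := by
  rintro _ ⟨x, hx, rfl⟩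
  refine mem_tightInterior.mpr fun c hc e₀ => ?_
  have : tightInteriorAt p R N c e₀ ≤ (tightInteriorAt p R N' c e₀).comap f :=
    tightInteriorAt_le fun e he g => mem_tightInteriorAt_of_linearMap he c (f ∘ₗ g)
  exact this (mem_tightInterior.mp hx c hc e₀)

/-- An `R`-linear map `ᵉR → ᵐR` that sends a multiple of `ᵉc` to `ᵐd` can be twisted to a map
`ᵉ⁺ᶠR → ᵐ⁺ᶠR` with the same effect, for every `f`. Thus each value at `ᵐ⁺ᶠd` of a map `ᵐ⁺ᶠR → N`
is also a value at `ᵉ⁺ᶠc`. -/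
theorem tightInteriorAt_le_of_transfer {N : Type*} [AddCommGroup N] [Module R N] {c d : R}
    {m e e₁ : ℕ} (he : e₁ ≤ e) (θ : R →+ R) (hθ : ∀ t y, θ (t ^ p ^ e * y) = t ^ p ^ m * θ y)
    (hc : ∃ r, θ (c * r) = d) : tightInteriorAt p R N d m ≤ tightInteriorAt p R N c e₁ := by
  obtain ⟨r, rfl⟩ := hc
  refine tightInteriorAt_le fun e' he' g => ?_
  obtain ⟨f, rfl⟩ := Nat.exists_eq_add_of_le he'
  let G : FrobeniusTwist p (e + f) R →ₗ[R] N :=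
    { toFun := fun y =>
        g (FrobeniusTwist.of p (m + f) R (θ ((FrobeniusTwist.of p (e + f) R).symm y * r)))
      map_add' := fun y z => by simp only [map_add, add_mul]
      map_smul' := fun t y => by
        rw [RingHom.id_apply, ← map_smul, FrobeniusTwist.smul_of]
        change g (FrobeniusTwist.of p (m + f) R
          (θ (t ^ p ^ (e + f) * (FrobeniusTwist.of p (e + f) R).symm y * r))) = _
        rw [mul_assoc, add_comm e f, pow_add, pow_mul, hθ, ← pow_mul, ← pow_add, add_comm f m,
          add_comm f e]
        rfl }
  exact mem_tightInteriorAt_of_linearMap (he.trans (Nat.le_add_right e f)) c G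

end

section

variable {p : ℕ} [Fact p.Prime] {A R : Type*} [CommRing A] [CharP A p] [CommRing R] [CharP R p]
  [Algebra A R]

/-- Existence of a test element: a single `d` and a single exponent compute the tight interior of
every `R`-module. -/
theorem exists_tightInterior_eq_tightInteriorAt [IsNoetherianRing A] [Module.Finite A R]
    [Module.IsTorsionFree A R] (hinj : Function.Injective (algebraMap A R))
    (hproj : ∀ e, Module.Projective A (FrobeniusTwist p e A)) :
    ∃ (m : ℕ), ∃ d ∈ nonZeroDivisors A, ∀ (N : Type*) [AddCommGroup N] [Module R N],
      tightInterior p R N = tightInteriorAt p R N (algebraMap A R d) m := by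
  have : IsReduced A := isReduced_of_projective_frobeniusTwist (p := p)
  obtain ⟨m, d, hd, hreg⟩ := exists_mem_nonZeroDivisors_mem_frobeniusTransferIdeal (p := p) hinj
  refine ⟨m, d, hreg, fun N _ _ => le_antisymm (fun x hx =>
    mem_tightInterior.mp hx _ (algebraMap_mem_offMinimalPrimes hreg) m) fun x hx =>
    mem_tightInterior.mpr fun c hc e₁ => ?_⟩
  obtain ⟨a, ha, r, har⟩ := exists_mem_nonZeroDivisors_algebraMap_eq_mul (A := A) hc
  obtain ⟨e, he, f, hf⟩ := exists_frobeniusTwist_linearMap_apply_eq_one hproj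
    (pow_mem ha (p ^ m)) e₁
  obtain ⟨θ, hθ, hθa⟩ := hd e f
  exact tightInteriorAt_le_of_transfer he θ hθ ⟨r, by rw [← har, hθa, hf, mul_one]⟩ hx

/-! ### Co-colon capturing -/

/-- The `A`-linear map `y ↦ G y 1` that corresponds to `G : ᵉR → Hom_A(R, N)` under the adjunction
`Hom_R(ᵉR, Hom_A(R, N)) ≃ Hom_A(ᵉR, N)`. -/
noncomputable def CoextendedHom.evalOne {e : ℕ} {N : Type*} [AddCommGroup N] [Module A N]
    (G : FrobeniusTwist p e R →ₗ[R] CoextendedHom A R N) : FrobeniusTwist p e R →ₗ[A] N where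
  toFun y := G y 1
  map_add' y z := by rw [map_add, add_apply]
  map_smul' a y := by
    have : a • y = algebraMap A R a • y := by
      change a ^ p ^ e • (FrobeniusTwist.of p e R).symm y =
        algebraMap A R a ^ p ^ e * (FrobeniusTwist.of p e R).symm y
      rw [← map_pow, Algebra.smul_def]
    rw [this, map_smul, smul_apply, one_mul, RingHom.id_apply, ← map_smul',
      Algebra.algebraMap_eq_smul_one]

/-- The `R`-linear map `ᵉR → Hom_A(R, M)`, `s ↦ (y ↦ k (y • s))`, that corresponds to
`k : ᵉR → M` under the adjunction `Hom_R(ᵉR, Hom_A(R, M)) ≃ Hom_A(ᵉR, M)`. -/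
noncomputable def CoextendedHom.ofTwist {e : ℕ} {M : Type*} [AddCommGroup M] [Module A M]
    (k : FrobeniusTwist p e R →ₗ[A] M) : FrobeniusTwist p e R →ₗ[R] CoextendedHom A R M where
  toFun s := show R →ₗ[A] M from
    { toFun := fun y => k (y • s)
      map_add' := fun y z => by rw [add_smul, map_add]
      map_smul' := fun a y => by
        rw [RingHom.id_apply, ← map_smul]
        congr 1
        change (a • y) ^ p ^ e * (FrobeniusTwist.of p e R).symm s =
          a ^ p ^ e • (y ^ p ^ e * (FrobeniusTwist.of p e R).symm s)
        rw [smul_pow, smul_mul_assoc] }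
  map_add' s t := by
    ext y
    change k (y • (s + t)) = k (y • s) + k (y • t)
    rw [smul_add, map_add]
  map_smul' r s := by
    ext y
    change k (y • r • s) = k ((y * r) • s)
    rw [mul_smul]

/-- The value at `ᵉ(c * d)` of a map `G : ᵉR → Hom_A(R, xM)` is `x` times the value at `ᵉd` of a
map `ᵉR → Hom_A(R, M)`: the map `ᵉR → xM` adjoint to `G`, composed with `ᵉc`, lifts along
`x : M → xM`. -/
theorem map_subtype_tightInteriorAt_mul_le {M : Type*} [AddCommGroup M] [Module A M] {x c : A}
    (hproj : ∀ e, Module.Projective A (FrobeniusTwist p e A))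
    (hc : algebraMap A (Module.End A R) c ∈ rankOneSpan A R) (d : R) (m : ℕ) :
    (tightInteriorAt p R (CoextendedHom A R ↥(x • (⊤ : Submodule A M)))
        (algebraMap A R c * d) m).map
        (CoextendedHom.map R (x • (⊤ : Submodule A M)).subtype) ≤
      x • tightInteriorAt p R (CoextendedHom A R M) d m := by
  rw [Submodule.map_le_iff_le_comap]
  refine tightInteriorAt_le fun e he G => ?_
  have hmem (y : M) : x • y ∈ x • (⊤ : Submodule A M) :=
    Submodule.smul_mem_pointwise_smul _ _ _ trivial
  let π : M →ₗ[A] ↥(x • (⊤ : Submodule A M)) := (LinearMap.lsmul A M x).codRestrict _ hmem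
  have hπ : Function.Surjective π := by
    rintro ⟨y, hy⟩
    obtain ⟨z, -, rfl⟩ := (Submodule.mem_smul_pointwise_iff_exists _ _ _).mp hy
    exact ⟨z, rfl⟩
  obtain ⟨k, hk⟩ := exists_lift_of_mem_rankOneSpan hπ hc (CoextendedHom.evalOne G)
  refine (Submodule.mem_smul_pointwise_iff_exists _ _ _).mpr
    ⟨_, mem_tightInteriorAt_of_linearMap he d (CoextendedHom.ofTwist k), ?_⟩
  ext y
  have h := congrArg Subtype.val (hk (y ^ p ^ e * d))
  rw [CoextendedHom.smul_apply', CoextendedHom.map_apply]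
  change x • k (FrobeniusTwist.of p e R (y ^ p ^ e * d)) = _
  refine h.trans (congrArg Subtype.val ?_)
  change G (FrobeniusTwist.of p e R (c • (y ^ p ^ e * d))) 1 = _
  rw [Algebra.smul_def, mul_left_comm, ← smul_eq_mul, ← FrobeniusTwist.smul_of, map_smul,
    CoextendedHom.smul_apply, one_mul]

end

/-- Co-colon capturing. Here `x • ⊤` is the submodule `xM` of `M`, and `Hom_A(R, xM)` is regarded
as a submodule of `Hom_A(R, M)` through the map induced by the inclusion `xM ⊆ M`. -/
theorem mainTheorem8 (p : ℕ) [Fact p.Prime]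
    (A : Type*) [CommRing A] [CharP A p] [IsRegularRing A] (hA : IsFFinite p A)
    (R : Type*) [CommRing R] [CharP R p] [Algebra A R]
    (hinj : Function.Injective (algebraMap A R)) [Module.Finite A R] [Module.IsTorsionFree A R]
    (M : Type*) [AddCommGroup M] [Module A M] (x : A) :
    (tightInterior p R (CoextendedHom A R ↥(x • (⊤ : Submodule A M)))).map
        (CoextendedHom.map R (x • (⊤ : Submodule A M)).subtype) =
      x • tightInterior p R (CoextendedHom A R M) := by
  have hproj (e : ℕ) := IsRegularRing.projective_frobeniusTwist hA e
  have : IsReduced A := isReduced_of_projective_frobeniusTwist (p := p)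
  refine le_antisymm ?_ ?_
  -- A lift of `g` depends on the element at which `g` is a value, so it is essential that
  -- membership in the tight interior on the right is tested by the one element `d`.
  · obtain ⟨m, d, hd, htest⟩ := exists_tightInterior_eq_tightInteriorAt hinj hproj
    obtain ⟨c, hc, hcR⟩ := exists_mem_nonZeroDivisors_algebraMap_mem_rankOneSpan (A := A) (R := R)
    rw [htest (CoextendedHom A R M)]
    refine (Submodule.map_mono fun g hg => ?_).trans
      (map_subtype_tightInteriorAt_mul_le hproj hcR (algebraMap A R d) m)
    rw [← map_mul]
    exact mem_tightInterior.mp hg _ (algebraMap_mem_offMinimalPrimes (mul_mem hc hd)) m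
  · intro g hg
    obtain ⟨g', hg', rfl⟩ := (Submodule.mem_smul_pointwise_iff_exists _ _ _).mp hg
    let π : M →ₗ[A] ↥(x • (⊤ : Submodule A M)) := (LinearMap.lsmul A M x).codRestrict _
      fun y => Submodule.smul_mem_pointwise_smul _ _ _ trivial
    exact ⟨CoextendedHom.map R π g', map_tightInterior_le _ ⟨g', hg', rfl⟩, rfl⟩
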